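/- **Setting.** Let $G=\langle S,M,\Gamma_1,\Gamma_2,\delta\rangle$ be a two-player concurrent game structure: $S$ and $M$ are finite, $\Gamma_i(s)\subseteq M$ is the nonempty set of moves available to player $i$ at $s$, and $\delta(s,a,b)$ is a probability distribution on $S$. Let $F\subseteq S$, $T=S\setminus F$, and let $\mathrm{Safe}(F)$ be the set of plays that stay in $F$ forever. Strategies map histories (nonempty finite sequences of states) to distributions on the available moves. For a player-1 strategy $\sigma_1$ put $\mathrm{Val}^{\sigma_1}(s)=\inf_{\sigma_2}\Pr_s^{\sigma_1,\sigma_2}(\mathrm{Safe}(F))$, let $\mathrm{Val}(\mathrm{Safe}(F))(s)=\sup_{\sigma_1}\mathrm{Val}^{\sigma_1}(s)$, and $W_1=\{s:\mathrm{Val}(\mathrm{Safe}(F))(s)=1\}$. Assume that all states in $W_1\cup T$ are absorbing. A selector $\gamma$ of player 1 assigns to each $s$ a distribution on $\Gamma_1(s)$; it is identified with the memoryless strategy $\overline\gamma$. A selector $x$ at a state $s\notin W_1\cup T$ is $k$-uniform if each of its probabilities has the form $i/j$ with integers $0\le i\le j\le k$, $j>0$; at states of $W_1\cup T$ every selector counts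 as $k$-uniform. For a family $\Lambda$ of sets $\Lambda(s)$ of player-1 selectors at $s$ (all selectors, or all $k$-uniform ones) and $v:S\to[0,1]$, let $\mathrm{Pre}_{x,y}(v)(s)$ be the expectation of $v$ at the successor of $s$ when the moves are drawn from $x,y$; $\mathrm{Pre}_x(v)(s)=\inf_y \mathrm{Pre}_{x,y}(v)(s)$; $\mathrm{Pre}^\Lambda(v)(s)=\sup_{x\in\Lambda(s)}\mathrm{Pre}_x(v)(s)$. A selector $x\in\Lambda(s)$ is optimal if $\mathrm{Pre}_x(v)(s)=\mathrm{Pre}^\Lambda(v)(s)$, and then its counter-optimal moves are the $b\in\Gamma_2(s)$ with $\mathrm{Pre}_{x,b}(v)(s)=\mathrm{Pre}^\Lambda(v)(s)$. The turn-based reduction $\overline G{}^\Lambda_v$ is the turn-based stochastic game in which at $s\in S$ player 1 moves to some $(s,A,B)$, where $A$ is the support and $B$ the set of counter-optimal moves of some optimal $x\in\Lambda(s)$; at $(s,A,B)$ player 2 moves to some $(s,A,b)$ with $b\in B$; and from $(s,A,b)$ the successor is uniform on $\bigcup_{a\in A}\mathrm{supp}\,\delta(s,a,b)$. A state of it is safe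 if its $S$-component is in $F$. Let $$I^\Lambda(v)=\{s\notin W_1\cup T:\mathrm{Pre}^\Lambda(v)(s)>v(s)\},\qquad U^\Lambda(v)=\{s\in S\setminus W_1: s\text{ has value }1\text{ for safety in }\overline G{}^\Lambda_v\}.$$ **The $k$-uniform restricted algorithm.** Replace $k$ by $\max\{k,|M|\}$, let $\Lambda$ be the $k$-uniform selectors and start with $\gamma$ = the selector that plays all available moves uniformly. Repeat, with $v=\mathrm{Val}^{\overline\gamma}$: if $I^\Lambda(v)\ne\emptyset$, replace $\gamma$ on $I^\Lambda(v)$ by optimal $k$-uniform selectors for $v$; if $I^\Lambda(v)=\emptyset\ne U^\Lambda(v)$, take a pure memoryless strategy $\overline\sigma$ that wins almost surely from all states of value 1 of $\overline G{}^\Lambda_v$, and replace $\gamma$ at each $s\in U^\Lambda(v)$ by an optimal $k$-uniform selector whose support $A$ and set $B$ of counter-optimal moves satisfy $\overline\sigma(s)=(s,A,B)$; if both sets are empty, stop and return $\gamma$. **The convergent algorithm (Algorithm 4).** Let $\gamma_0$ be the uniform selector. In iteration $i=0,1,2,\dots$ let $\gamma_{i+1}$ be an output of the $k$-uniform restricted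 algorithm for $k=|M|+i$; then, if for $\Lambda$ = all selectors both $I^\Lambda(v_i)$ and $U^\Lambda(v_i)$ are empty, stop and return $\gamma_{i+1}$. Here $v_i=\mathrm{Val}^{\overline\gamma_i}$. After a stop the sequence is continued by its last term. **Theorem 8 (Monotonicity, optimality on termination, convergence).** For every $k$, every execution of the $k$-uniform restricted algorithm terminates (so that Algorithm 4 is well defined and has runs). For every run of Algorithm 4, whatever choices are made: 1. $v_{i+1}\ge v_i$ for all $i\ge 0$. 2. If the algorithm terminates in iteration $i$, then $v_i=\mathrm{Val}(\mathrm{Safe}(F))$, and the returned strategy $\overline\gamma_{i+1}$ also has $v_{i+1}=\mathrm{Val}(\mathrm{Safe}(F))$. 3. For every $\varepsilon>0$ there is an $i$ such that $v_i(s)\ge \mathrm{Val}(\mathrm{Safe}(F))(s)-\varepsilon$ for all $s\in S$. 4. $v_i\le\mathrm{Val}(\mathrm{Safe}(F))$ for all $i$, and $\lim_{i\to\infty}v_i=\mathrm{Val}(\mathrm{Safe}(F))$. -/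

import Mathlib

open MeasureTheory ProbabilityTheory Filter Topology

noncomputable section

/-- A two-player concurrent game structure with state space `S` and moves `M` (both are assumed
finite where this matters): nonempty sets of available moves at each state, and a probabilistic
transition function. -/
structure ConcurrentGame (S M : Type*) where
  mov₁ : S → Finset M
  mov₂ : S → Finset M
  mov₁_nonempty : ∀ s, (mov₁ s).Nonempty
  mov₂_nonempty : ∀ s, (mov₂ s).Nonempty
  trans : S → M → M → PMF S

/-- The set of plays that stay in `F` forever. -/
def SafePlays {S : Type*} (F : Set S) : Set (ℕ → S) := {ω | ∀ n, ω n ∈ F}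

namespace ConcurrentGame

variable {S M : Type*} (G : ConcurrentGame S M)

/-- `s` is absorbing: whatever available moves are chosen, the successor of `s` is `s`. -/
def Absorbing (s : S) : Prop := ∀ a ∈ G.mov₁ s, ∀ b ∈ G.mov₂ s, G.trans s a b s = 1

/-- Selectors of player 1 at the state `s`. -/
def Sel₁ (s : S) : Set (PMF M) := {x | ∀ a, x a ≠ 0 → a ∈ G.mov₁ s}

/-- Selectors of player 2 at the state `s`. -/
def Sel₂ (s : S) : Set (PMF M) := {y | ∀ b, y b ≠ 0 → b ∈ G.mov₂ s}

/-- Selectors of player 1. -/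
def Selector₁ : Type _ := {ξ : S → PMF M // ∀ s, ξ s ∈ G.Sel₁ s}

/-- Strategies of player 1; `σ w s` is the distribution played after the history `w · s`, where
`s` is the current state and `w` is the list of the earlier states, in order. -/
def Strategy₁ : Type _ := {σ : List S → S → PMF M // ∀ w s, σ w s ∈ G.Sel₁ s}

/-- Strategies of player 2, likewise. -/
def Strategy₂ : Type _ := {σ : List S → S → PMF M // ∀ w s, σ w s ∈ G.Sel₂ s}

/-- The memoryless strategy that plays the selector `ξ` forever. -/
def memoryless {G : ConcurrentGame S M} (ξ : G.Selector₁) : G.Strategy₁ :=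
  ⟨fun _ s => ξ.1 s, fun _ s => ξ.2 s⟩

/-- Distribution of the successor state after the history `w · s`. -/
def nextState (σ₁ : G.Strategy₁) (σ₂ : G.Strategy₂) (w : List S) (s : S) : PMF S :=
  (σ₁.1 w s).bind fun a => (σ₂.1 w s).bind fun b => G.trans s a b

section Measure

variable [MeasurableSpace S] [DiscreteMeasurableSpace S] [Countable S]

/-- The transition kernel at time `n`: from the states at times `0, …, n` to the next state. -/
def stepKernel (σ₁ : G.Strategy₁) (σ₂ : G.Strategy₂) (n : ℕ) :
    Kernel (Finset.Iic n → S) S :=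
  Kernel.ofFunOfCountable fun h =>
    (G.nextState σ₁ σ₂
      (List.ofFn fun i : Fin n => h ⟨i, Finset.mem_Iic.2 i.2.le⟩)
      (h ⟨n, Finset.mem_Iic.2 le_rfl⟩)).toMeasure

instance (σ₁ : G.Strategy₁) (σ₂ : G.Strategy₂) (n : ℕ) :
    IsMarkovKernel (G.stepKernel σ₁ σ₂ n) :=
  ⟨fun _ => PMF.toMeasure.isProbabilityMeasure _⟩

/-- The law of the play that starts in `s` when the players follow `σ₁` and `σ₂`
(the Ionescu-Tulcea measure). -/
def playMeasure (σ₁ : G.Strategy₁) (σ₂ : G.Strategy₂) (s : S) : Measure (ℕ → S) :=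
  Kernel.traj (X := fun _ => S) (G.stepKernel σ₁ σ₂) 0 (fun _ => s)

end Measure

section Value

variable [Countable S]

/-- The probability of the event `Φ` from `s` under `σ₁` and `σ₂` (the countable state space
carries the discrete σ-algebra). -/
def prob (σ₁ : G.Strategy₁) (σ₂ : G.Strategy₂) (Φ : Set (ℕ → S)) (s : S) : ℝ :=
  letI : MeasurableSpace S := ⊤
  haveI : DiscreteMeasurableSpace S := ⟨fun _ => trivial⟩
  (G.playMeasure σ₁ σ₂ s).real Φ

/-- What the strategy `σ₁` guarantees for the objective `Φ`, against all strategies. -/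
def stratVal (σ₁ : G.Strategy₁) (Φ : Set (ℕ → S)) (s : S) : ℝ :=
  ⨅ σ₂ : G.Strategy₂, G.prob σ₁ σ₂ Φ s

/-- The value of the objective `Φ` for player 1. -/
def val (Φ : Set (ℕ → S)) (s : S) : ℝ := ⨆ σ₁ : G.Strategy₁, G.stratVal σ₁ Φ s

/-- The states of value 1 for the objective to stay in `F`. -/
def almostSure (F : Set S) : Set S := {s | G.val (SafePlays F) s = 1}

/-- The valuation of the memoryless strategy of `γ` for the objective to stay in `F`. -/
def selVal {G : ConcurrentGame S M} (F : Set S) (γ : G.Selector₁) : S → ℝ :=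
  G.stratVal (memoryless γ) (SafePlays F)

end Value

section Pre

variable [Fintype S] [Fintype M]

/-- One-step expectation of `v` at `s` when the players draw their moves from `x` and `y`. -/
def preMix (v : S → ℝ) (s : S) (x y : PMF M) : ℝ :=
  ∑ a, ∑ b, ∑ t, v t * (G.trans s a b t).toReal * (x a).toReal * (y b).toReal

/-- One-step expectation of `v` at `s` that player 1 guarantees by drawing from `x`. -/
def preSel (v : S → ℝ) (s : S) (x : PMF M) : ℝ := ⨅ y : G.Sel₂ s, G.preMix v s x y

/-- The best one-step expectation of `v` at `s` that player 1 guarantees by a selector from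
`Adm s`. The families `Adm` in use are `G.Sel₁` (all selectors) and `G.SelK F k`. -/
def preSup (Adm : S → Set (PMF M)) (v : S → ℝ) (s : S) : ℝ :=
  ⨆ x : Adm s, G.preSel v s x

/-- The selectors from `Adm s` that are optimal for `v` at `s`. -/
def OptSel (Adm : S → Set (PMF M)) (v : S → ℝ) (s : S) : Set (PMF M) :=
  {x | x ∈ Adm s ∧ G.preSel v s x = G.preSup Adm v s}

open Classical in
/-- The counter-optimal moves of player 2 against `x`. -/
def countOpt (Adm : S → Set (PMF M)) (v : S → ℝ) (s : S) (x : PMF M) : Finset M :=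
  (G.mov₂ s).filter fun b => G.preMix v s x (PMF.pure b) = G.preSup Adm v s

open Classical in
/-- The set of moves that `x` plays with positive probability. -/
def supp (x : PMF M) : Finset M := Finset.univ.filter fun a => x a ≠ 0

/-- Pairs (support of an optimal selector, its set of counter-optimal moves). -/
def OptSelCount (Adm : S → Set (PMF M)) (v : S → ℝ) (s : S) : Set (Finset M × Finset M) :=
  {p | ∃ x ∈ G.OptSel Adm v s, supp x = p.1 ∧ G.countOpt Adm v s x = p.2}

end Pre

end ConcurrentGame

/-- Who determines the successor of a state of a turn-based game. -/
inductive Owner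
  | player1
  | player2
  | random

/-- A turn-based stochastic game graph with state space `V`; `succ x` is the set of successors of
`x` along the edges. -/
structure TurnBasedGame (V : Type*) where
  owner : V → Owner
  succ : V → Finset V
  succ_nonempty : ∀ x, (succ x).Nonempty
  trans : V → PMF V
  trans_pos_iff : ∀ x, owner x = Owner.random → ∀ y, trans x y ≠ 0 ↔ y ∈ succ x

open Classical in
/-- A turn-based stochastic game as a concurrent game: a move is the name of a successor, and a
player who does not own the current state has just one (irrelevant) move there. -/
def TurnBasedGame.toConcurrent {V : Type*} (H : TurnBasedGame V) : ConcurrentGame V V where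
  mov₁ x := match H.owner x with
    | .player1 => H.succ x
    | _ => {x}
  mov₂ x := match H.owner x with
    | .player2 => H.succ x
    | _ => {x}
  mov₁_nonempty x := by
    cases h : H.owner x <;> simp [H.succ_nonempty]
  mov₂_nonempty x := by
    cases h : H.owner x <;> simp [H.succ_nonempty]
  trans x a b := match H.owner x with
    | .player1 => PMF.pure a
    | .player2 => PMF.pure b
    | .random => H.trans x

/-- Names for the states of the turn-based reduction: `s`, `(s, A, B)` and `(s, A, b)`. -/
inductive TBName (S M : Type*)
  | base (s : S)
  | pair (s : S) (A B : Finset M)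
  | act (s : S) (A : Finset M) (b : M)

namespace TBName

variable {S M : Type*}

instance [Finite S] [Finite M] : Finite (TBName S M) := by
  let f : TBName S M → S ⊕ (S × Finset M × Finset M) ⊕ (S × Finset M × M) := fun x =>
    match x with
    | base s => .inl s
    | pair s A B => .inr (.inl (s, A, B))
    | act s A b => .inr (.inr (s, A, b))
  refine Finite.of_injective f ?_
  rintro (_ | _ | _) (_ | _ | _) h <;> simp_all [f]

/-- The underlying state of the original game. -/
def state : TBName S M → S
  | base s => s
  | pair s _ _ => s
  | act s _ _ => s

/-- The owner of a state of the reduction. -/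
def owner : TBName S M → Owner
  | base _ => .player1
  | pair _ _ _ => .player2
  | act _ _ _ => .random

end TBName

namespace ConcurrentGame

variable {S M : Type*} [Fintype S] [Fintype M] (G : ConcurrentGame S M)

/-- The names that are states of the turn-based reduction for `v` and `Adm`. -/
def TBValid (Adm : S → Set (PMF M)) (v : S → ℝ) : TBName S M → Prop
  | .base _ => True
  | .pair s A B => (A, B) ∈ G.OptSelCount Adm v s
  | .act s A b => ∃ B, (A, B) ∈ G.OptSelCount Adm v s ∧ b ∈ B

/-- The states of the turn-based reduction. -/
def TBState (Adm : S → Set (PMF M)) (v : S → ℝ) : Type _ :=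
  {x : TBName S M // G.TBValid Adm v x}

instance (Adm : S → Set (PMF M)) (v : S → ℝ) : Finite (G.TBState Adm v) :=
  inferInstanceAs (Finite {x : TBName S M // G.TBValid Adm v x})

instance (Adm : S → Set (PMF M)) (v : S → ℝ) : Fintype (G.TBState Adm v) :=
  Fintype.ofFinite _

/-- The state `s` of the game, as a state of the turn-based reduction. -/
def tbBase (Adm : S → Set (PMF M)) (v : S → ℝ) (s : S) : G.TBState Adm v := ⟨.base s, trivial⟩

/-- The edges of the turn-based reduction. -/
def TBEdge : TBName S M → TBName S M → Prop
  | .base s, .pair s' _ _ => s' = s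
  | .pair s A B, .act s' A' b => s' = s ∧ A' = A ∧ b ∈ B
  | .act s A b, .base t => ∃ a ∈ A, G.trans s a b t ≠ 0
  | _, _ => False

open Classical in
/-- The successors of a state of the turn-based reduction. There is always one when optimal
selectors from `Adm` exist; the self-loop in the other case only makes the definition total. -/
def tbSucc (Adm : S → Set (PMF M)) (v : S → ℝ) (x : G.TBState Adm v) :
    Finset (G.TBState Adm v) :=
  if (Finset.univ.filter fun y : G.TBState Adm v => G.TBEdge x.1 y.1).Nonempty then
    Finset.univ.filter fun y : G.TBState Adm v => G.TBEdge x.1 y.1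
  else {x}

theorem tbSucc_nonempty (Adm : S → Set (PMF M)) (v : S → ℝ) (x : G.TBState Adm v) :
    (G.tbSucc Adm v x).Nonempty := by
  unfold tbSucc
  split_ifs with h
  · exact h
  · exact Finset.singleton_nonempty x

/-- The turn-based reduction of the game with respect to the valuation `v`, where player 1 is
restricted to selectors from `Adm`. -/
def tbReduction (Adm : S → Set (PMF M)) (v : S → ℝ) : TurnBasedGame (G.TBState Adm v) where
  owner x := x.1.owner
  succ := G.tbSucc Adm v
  succ_nonempty := G.tbSucc_nonempty Adm v
  trans x := PMF.uniformOfFinset (G.tbSucc Adm v x) (G.tbSucc_nonempty Adm v x)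
  trans_pos_iff x _ y := by
    rw [← PMF.mem_support_iff, PMF.mem_support_uniformOfFinset_iff]

/-- The turn-based reduction, as a concurrent game. -/
abbrev tbGame (Adm : S → Set (PMF M)) (v : S → ℝ) :
    ConcurrentGame (G.TBState Adm v) (G.TBState Adm v) :=
  (G.tbReduction Adm v).toConcurrent

/-- The safe states of the turn-based reduction. -/
def tbSafe (Adm : S → Set (PMF M)) (v : S → ℝ) (F : Set S) : Set (G.TBState Adm v) :=
  {x | x.1.state ∈ F}

/-- The almost-sure winning states of the turn-based reduction. -/
def tbAlmostSure (Adm : S → Set (PMF M)) (v : S → ℝ) (F : Set S) : Set (G.TBState Adm v) :=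
  (G.tbGame Adm v).almostSure (G.tbSafe Adm v F)

/-- A selector that plays one move with probability 1 at every state. -/
def IsPure {G : ConcurrentGame S M} (ξ : G.Selector₁) : Prop := ∀ s, ∃ a, ξ.1 s = PMF.pure a

/-- `ξ` is a pure memoryless almost-sure winning strategy from all the almost-sure winning states
of the turn-based reduction. -/
def TBWinning (Adm : S → Set (PMF M)) (v : S → ℝ) (F : Set S)
    (ξ : (G.tbGame Adm v).Selector₁) : Prop :=
  IsPure ξ ∧ ∀ x ∈ G.tbAlmostSure Adm v F, selVal (G.tbSafe Adm v F) ξ x = 1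

/-- The states, neither unsafe nor of value 1, at which the one-step operator improves `v`. -/
def improvable (Adm : S → Set (PMF M)) (F : Set S) (v : S → ℝ) : Set S :=
  {s | s ∈ F ∧ s ∉ G.almostSure F ∧ v s < G.preSup Adm v s}

/-- The states not of value 1 that are almost-sure winning in the turn-based reduction. -/
def tbImprovable (Adm : S → Set (PMF M)) (F : Set S) (v : S → ℝ) : Set S :=
  {s | G.tbBase Adm v s ∈ G.tbAlmostSure Adm v F ∧ s ∉ G.almostSure F}

/-- Neither kind of improvement is possible at `v`. -/
def NoImprovement (Adm : S → Set (PMF M)) (F : Set S) (v : S → ℝ) : Prop :=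
  G.improvable Adm F v = ∅ ∧ G.tbImprovable Adm F v = ∅

/-- The `k`-uniform selectors at `s`: if `s` is neither unsafe nor of value 1, then all
probabilities are fractions with denominator at most `k`. -/
def SelK (F : Set S) (k : ℕ) (s : S) : Set (PMF M) :=
  {x | x ∈ G.Sel₁ s ∧ (s ∈ F → s ∉ G.almostSure F →
    ∀ a, x a ≠ 0 → ∃ i j : ℕ, 0 < j ∧ i ≤ j ∧ j ≤ k ∧ (x a).toReal = (i : ℝ) / j)}

/-- The selector that plays all available moves uniformly at random. -/
def uniformSelector : G.Selector₁ :=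
  ⟨fun s => PMF.uniformOfFinset (G.mov₁ s) (G.mov₁_nonempty s), fun s a h => by
    rwa [← PMF.mem_support_iff, PMF.mem_support_uniformOfFinset_iff] at h⟩

/-- One-step improvement: at the improvable states, `γ` is replaced by a best selector from
`Adm`. -/
def ImproveByPre (Adm : S → Set (PMF M)) (F : Set S) (γ γ' : G.Selector₁) : Prop :=
  (G.improvable Adm F (selVal F γ)).Nonempty ∧
  ∃ ξ : G.Selector₁, (∀ s, ξ.1 s ∈ Adm s) ∧
    (∀ s ∈ G.improvable Adm F (selVal F γ),
      G.preSel (selVal F γ) s (ξ.1 s) = G.preSup Adm (selVal F γ) s) ∧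
    (∀ s ∈ G.improvable Adm F (selVal F γ), γ'.1 s = ξ.1 s) ∧
    (∀ s ∉ G.improvable Adm F (selVal F γ), γ'.1 s = γ.1 s)

/-- Improvement by the turn-based reduction, when one-step improvement is impossible: `γ` is
replaced by optimal selectors that follow a pure memoryless almost-sure winning strategy of the
reduction, i.e. whose support and set of counter-optimal moves are the ones it chooses. -/
def ImproveByTB (Adm : S → Set (PMF M)) (F : Set S) (γ γ' : G.Selector₁) : Prop :=
  G.improvable Adm F (selVal F γ) = ∅ ∧ (G.tbImprovable Adm F (selVal F γ)).Nonempty ∧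
  ∃ σ : (G.tbGame Adm (selVal F γ)).Selector₁, G.TBWinning Adm (selVal F γ) F σ ∧
    (∀ s ∈ G.tbImprovable Adm F (selVal F γ),
      γ'.1 s ∈ G.OptSel Adm (selVal F γ) s ∧
      ∃ y : G.TBState Adm (selVal F γ),
        y.1 = .pair s (supp (γ'.1 s)) (G.countOpt Adm (selVal F γ) s (γ'.1 s)) ∧
        σ.1 (G.tbBase Adm (selVal F γ) s) = PMF.pure y) ∧
    (∀ s ∉ G.tbImprovable Adm F (selVal F γ), γ'.1 s = γ.1 s)

/-- One iteration of the `k`-uniform restricted strategy-improvement algorithm that changes the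
current selector `γ` to `γ'` (the algorithm leaves some choices open). -/
def KStep (F : Set S) (k : ℕ) (γ γ' : G.Selector₁) : Prop :=
  G.ImproveByPre (G.SelK F (max k (Fintype.card M))) F γ γ' ∨
    G.ImproveByTB (G.SelK F (max k (Fintype.card M))) F γ γ'

/-- The stopping condition of the `k`-uniform restricted algorithm. -/
def KFinal (F : Set S) (k : ℕ) (γ : G.Selector₁) : Prop :=
  G.NoImprovement (G.SelK F (max k (Fintype.card M))) F (selVal F γ)

/-- `γ` occurs in an execution of the `k`-uniform restricted algorithm. -/
def KReachable (F : Set S) (k : ℕ) (γ : G.Selector₁) : Prop :=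
  Relation.ReflTransGen (G.KStep F k) G.uniformSelector γ

/-- `γ` is a possible output of the `k`-uniform restricted algorithm. -/
def KOutput (F : Set S) (k : ℕ) (γ : G.Selector₁) : Prop :=
  G.KReachable F k γ ∧ G.KFinal F k γ

/-- Every execution of the `k`-uniform restricted algorithm ends with an output: it cannot go on
forever, and it cannot get stuck. -/
def KTerminates (F : Set S) (k : ℕ) : Prop :=
  (¬ ∃ g : ℕ → G.Selector₁, g 0 = G.uniformSelector ∧ ∀ n, G.KStep F k (g n) (g (n + 1))) ∧
  ∀ γ, G.KReachable F k γ → G.KFinal F k γ ∨ ∃ γ', G.KStep F k γ γ'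

/-- The stopping condition of the convergent algorithm (no restriction on selectors). -/
def Stops (F : Set S) (γ : G.Selector₁) : Prop := G.NoImprovement G.Sel₁ F (selVal F γ)

/-- `γ 0, γ 1, …` is a run of the convergent algorithm: `γ 0` is the uniform selector, the
iteration `i` computes `γ (i + 1)` by the `k`-uniform restricted algorithm with `k = |M| + i`, and
then the algorithm stops and returns `γ (i + 1)` if `γ i` fulfils the stopping condition. After the
algorithm has stopped, the sequence is continued by its last term. -/
def IsRun (F : Set S) (γ : ℕ → G.Selector₁) : Prop :=
  γ 0 = G.uniformSelector ∧
  ∀ i, ((∀ j < i, ¬ G.Stops F (γ j)) → G.KOutput F (Fintype.card M + i) (γ (i + 1))) ∧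
    ((∃ j < i, G.Stops F (γ j)) → γ (i + 1) = γ i)

end ConcurrentGame

end

set_option linter.unusedSectionVars false
set_option linter.style.haveILetI false

noncomputable section

namespace ConcurrentGame

/-! ### One-step expectations as finite sums. -/

section PreMix

variable {S M : Type*} [Fintype S] [Fintype M] (G : ConcurrentGame S M)

/-! Two principles carry everything. The first is a submartingale test, `le_selVal`: a function `u ≤
1` that vanishes off `F` and satisfies `u ≤ Pre_γ(u)` on `F` is a lower bound for what `γ`
guarantees. The second is the converse supply of such functions. The optimal probabilities of
staying safe for `n` steps decrease to a limit, and by compactness of the set of selectors some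
memoryless strategy attains this limit (`exists_selVal_eq_limitVal`). Hence `Val^γ` is a fixed point
of `Pre_γ` on `F`, and the value of the game is attained by a selector (`exists_selVal_eq_val`).

Each improvement step strictly increases the valuation `v`. For a one-step improvement the test is
applied to `v` itself. For an improvement by the reduction it is applied to `v + ε (1 - v)` on `U`
and `v` elsewhere: counter-optimal moves lead only to states that are almost-sure winning in the
reduction, and all other moves leave a positive gap that absorbs a small `ε`
(`ImproveByTB.exists_add_le`). Only finitely many `k`-uniform selectors can occur, so executions
terminate.

A selector `γ` without improvements is optimal among the admissible selectors
(`selVal_le_of_noImprovement`). If `ξ` were better somewhere, the states where `Val^ξ - Val^γ` is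
maximal would be closed under the moves of `ξ` and the counter-optimal replies, hence almost-sure
winning in the reduction, and an improvement would be possible. With all selectors admissible, this
is optimality on termination. With `k`-uniform ones, it says that an output beats every `k`-uniform
selector, in particular the previous output.

For convergence it remains to find near-optimal rational selectors (`exists_rational_near_optimal`).
Naive rounding of an optimal selector can destroy its value, since safety values are not continuous
in the selector. Replacing the value `w` by `(1 - δ) w + δ w²` costs at most `δ`. By strict
convexity it makes the test strict for every move after which `w` is not constant, while for the
remaining moves the test depends only on the support. -/

theorem _root_.PMF.sum_toReal {α : Type*} [Fintype α] (p : PMF α) : ∑ a, (p a).toReal = 1 := by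
  rw [← ENNReal.toReal_sum fun a _ => p.apply_ne_top a, ← tsum_fintype (L := .unconditional _),
    p.tsum_coe, ENNReal.toReal_one]

theorem preMix_eq_sum (v : S → ℝ) (s : S) (x y : PMF M) :
    G.preMix v s x y = ∑ b, (y b).toReal * ∑ a, (x a).toReal * ∑ t, (G.trans s a b t).toReal * v t := by
  unfold preMix
  rw [Finset.sum_comm]
  simp only [Finset.mul_sum]
  refine Finset.sum_congr rfl fun b _ => Finset.sum_congr rfl fun a _ =>
    Finset.sum_congr rfl fun t _ => ?_
  ring

theorem preMix_pure (v : S → ℝ) (s : S) (x : PMF M) (b : M) :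
    G.preMix v s x (PMF.pure b) =
      ∑ a, (x a).toReal * ∑ t, (G.trans s a b t).toReal * v t := by
  classical
  rw [preMix_eq_sum, Finset.sum_eq_single b]
  · simp
  · intro c _ hc
    simp [PMF.pure_apply, hc]
  · simp

theorem preMix_eq_sum_pure (v : S → ℝ) (s : S) (x y : PMF M) :
    G.preMix v s x y = ∑ b, (y b).toReal * G.preMix v s x (PMF.pure b) := by
  simp only [preMix_pure, ← preMix_eq_sum]

theorem preMix_mono {u v : S → ℝ} (h : ∀ t, u t ≤ v t) (s : S) (x y : PMF M) :
    G.preMix u s x y ≤ G.preMix v s x y := by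
  unfold preMix
  gcongr with a _ b _ t _
  exact h t

theorem preMix_add (u v : S → ℝ) (s : S) (x y : PMF M) :
    G.preMix (fun t => u t + v t) s x y = G.preMix u s x y + G.preMix v s x y := by
  simp only [preMix, add_mul, Finset.sum_add_distrib]

theorem preMix_const_mul (c : ℝ) (v : S → ℝ) (s : S) (x y : PMF M) :
    G.preMix (fun t => c * v t) s x y = c * G.preMix v s x y := by
  simp only [preMix, Finset.mul_sum, mul_assoc]

theorem preMix_const (c : ℝ) (s : S) (x y : PMF M) : G.preMix (fun _ => c) s x y = c := by
  rw [preMix_eq_sum]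
  simp only [← Finset.sum_mul, PMF.sum_toReal, one_mul]

theorem toReal_nextState (σ₁ : G.Strategy₁) (σ₂ : G.Strategy₂) (w : List S) (s t : S) :
    (G.nextState σ₁ σ₂ w s t).toReal =
      ∑ a, ∑ b, (G.trans s a b t).toReal * (σ₁.1 w s a).toReal * (σ₂.1 w s b).toReal := by
  unfold nextState
  simp only [PMF.bind_apply, tsum_fintype]
  rw [ENNReal.toReal_sum]
  · refine Finset.sum_congr rfl fun a _ => ?_
    rw [ENNReal.toReal_mul, ENNReal.toReal_sum, Finset.mul_sum]
    · refine Finset.sum_congr rfl fun b _ => ?_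
      rw [ENNReal.toReal_mul]
      ring
    · intro b _
      exact ENNReal.mul_ne_top (PMF.apply_ne_top _ _) (PMF.apply_ne_top _ _)
  · intro a _
    exact ENNReal.mul_ne_top (PMF.apply_ne_top _ _)
      (ENNReal.sum_ne_top.2 fun b _ => ENNReal.mul_ne_top (PMF.apply_ne_top _ _) (PMF.apply_ne_top _ _))

theorem sum_nextState (σ₁ : G.Strategy₁) (σ₂ : G.Strategy₂) (w : List S) (s : S) (v : S → ℝ) :
    ∑ t, (G.nextState σ₁ σ₂ w s t).toReal * v t = G.preMix v s (σ₁.1 w s) (σ₂.1 w s) := by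
  simp only [toReal_nextState, Finset.sum_mul, preMix]
  rw [Finset.sum_comm]
  refine Finset.sum_congr rfl fun a _ => ?_
  rw [Finset.sum_comm]
  refine Finset.sum_congr rfl fun b _ => Finset.sum_congr rfl fun t _ => ?_
  ring

end PreMix

/-! ### The law of the play: expectations over safe prefixes. -/

section Play

variable {S M : Type*} [Fintype S] [Fintype M] (G : ConcurrentGame S M)
  [MeasurableSpace S] [DiscreteMeasurableSpace S]

instance (σ₁ : G.Strategy₁) (σ₂ : G.Strategy₂) (s : S) :
    IsProbabilityMeasure (G.playMeasure σ₁ σ₂ s) := by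
  unfold playMeasure
  infer_instance

/-- The states visited before time `n`, in order. -/
def history (ω : ℕ → S) (n : ℕ) : List S := List.ofFn fun i : Fin n => ω i

theorem integral_play_zero (σ₁ : G.Strategy₁) (σ₂ : G.Strategy₂) (s : S) (h : S → ℝ) :
    ∫ ω, h (ω 0) ∂G.playMeasure σ₁ σ₂ s = h s := by
  unfold playMeasure
  have h1 := Kernel.traj_map_frestrictLe_apply (X := fun _ => S) (κ := G.stepKernel σ₁ σ₂) 0 0
    (fun _ => s)
  rw [Kernel.partialTraj_self, Kernel.id_apply] at h1
  have h2 : ∫ ω, h (ω 0) ∂(Kernel.traj (X := fun _ => S) (G.stepKernel σ₁ σ₂) 0 (fun _ => s)) =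
      ∫ x, h (x ⟨0, by simp⟩) ∂((Kernel.traj (X := fun _ => S) (G.stepKernel σ₁ σ₂) 0
        (fun _ => s)).map (Preorder.frestrictLe 0)) := by
    rw [integral_map (by fun_prop) (measurable_of_countable _).aestronglyMeasurable]
    rfl
  rw [h2, h1, integral_dirac]

/-- This is the tower property: conditioned on the states up to time `n`, the law of the next state
is `nextState`, whose expectation of `h` is `preMix`. The factor `φ` is an arbitrary function of the
past and is later used as the indicator of safety so far. -/
theorem integral_play_succ (σ₁ : G.Strategy₁) (σ₂ : G.Strategy₂) (s : S) (n : ℕ)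
    (φ : (Finset.Iic n → S) → ℝ) (h : S → ℝ) :
    ∫ ω, φ (Preorder.frestrictLe (π := fun _ => S) n ω) * h (ω (n + 1)) ∂G.playMeasure σ₁ σ₂ s =
      ∫ ω, φ (Preorder.frestrictLe (π := fun _ => S) n ω) *
        G.preMix h (ω n) (σ₁.1 (history ω n) (ω n)) (σ₂.1 (history ω n) (ω n))
        ∂G.playMeasure σ₁ σ₂ s := by
  have hS : ∀ f : S → ℝ, ∃ C, ∀ x, ‖f x‖ ≤ C := fun f => by
    obtain ⟨C, hC⟩ := (Set.finite_range fun x => ‖f x‖).bddAbove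
    exact ⟨C, fun x => hC ⟨x, rfl⟩⟩
  have hφ : ∃ C, ∀ x, ‖φ x‖ ≤ C := by
    obtain ⟨C, hC⟩ := (Set.finite_range fun x => ‖φ x‖).bddAbove
    exact ⟨C, fun x => hC ⟨x, rfl⟩⟩
  obtain ⟨C, hC⟩ := hS h
  obtain ⟨D, hD⟩ := hφ
  have mφ : Measurable φ := measurable_of_countable φ
  have mh : Measurable h := measurable_of_countable h
  unfold playMeasure
  have key := Kernel.integral_traj_partialTraj' (X := fun _ => S) (κ := G.stepKernel σ₁ σ₂)
    (Nat.zero_le n) (x₀ := fun _ => s) (f := fun x y => φ x * h (y (n + 1))) (by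
      refine Integrable.of_bound (C := D * C) ?_ ?_
      · refine Measurable.aestronglyMeasurable ?_
        unfold Function.uncurry
        fun_prop
      · refine ae_of_all _ fun x => ?_
        simp only [Function.uncurry, norm_mul]
        exact mul_le_mul (hD _) (hC _) (norm_nonneg _) ((norm_nonneg _).trans (hD x.1)))
  refine Eq.trans key.symm ?_
  have inner : ∀ x : Finset.Iic n → S,
      ∫ y, h (y (n + 1)) ∂(Kernel.traj (X := fun _ => S) (G.stepKernel σ₁ σ₂) n x) =
      G.preMix h (x ⟨n, Finset.mem_Iic.2 le_rfl⟩)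
        (σ₁.1 (List.ofFn fun i : Fin n => x ⟨i, Finset.mem_Iic.2 i.2.le⟩)
          (x ⟨n, Finset.mem_Iic.2 le_rfl⟩))
        (σ₂.1 (List.ofFn fun i : Fin n => x ⟨i, Finset.mem_Iic.2 i.2.le⟩)
          (x ⟨n, Finset.mem_Iic.2 le_rfl⟩)) := by
    intro x
    have h1 := congrArg (fun k => k x) (Kernel.map_traj_succ_self (X := fun _ => S)
      (κ := G.stepKernel σ₁ σ₂) (a := n))
    replace h1 := (Kernel.map_apply _ (by fun_prop) x).symm.trans h1
    refine Eq.trans ?_ (G.sum_nextState σ₁ σ₂ _ _ h)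
    have h2 : ∫ y, h (y (n + 1)) ∂(Kernel.traj (X := fun _ => S) (G.stepKernel σ₁ σ₂) n x) =
        ∫ t, h t ∂((Kernel.traj (X := fun _ => S) (G.stepKernel σ₁ σ₂) n x).map
          (fun y => y (n + 1))) := by
      rw [integral_map (measurable_pi_apply (n + 1)).aemeasurable (by fun_prop)]
    rw [h2, h1]
    change ∫ t, h t ∂(PMF.toMeasure _) = _
    rw [PMF.integral_eq_sum]
    rfl
  refine (integral_congr_ae (ae_of_all _ fun x =>
    (integral_const_mul _ _).trans (congrArg (φ x * ·) (inner x)))).trans ?_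
  rw [← Kernel.traj_map_frestrictLe_apply, integral_map (by fun_prop)
    (measurable_of_countable _).aestronglyMeasurable]
  rfl

open Classical in
/-- The expectation of `h` at time `n` on the plays that are safe up to time `n`. -/
def safeExpect (F : Set S) (σ₁ : G.Strategy₁) (σ₂ : G.Strategy₂) (s : S) (n : ℕ) (h : S → ℝ) : ℝ :=
  ∫ ω, (if ∀ i ≤ n, ω i ∈ F then 1 else 0) * h (ω n) ∂G.playMeasure σ₁ σ₂ s

theorem measurable_history_fun {n : ℕ} (f : (Finset.Iic n → S) → ℝ) :
    Measurable fun ω : ℕ → S => f (Preorder.frestrictLe (π := fun _ => S) n ω) :=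
  (measurable_of_countable f).comp (by fun_prop)

theorem integrable_history_fun (σ₁ : G.Strategy₁) (σ₂ : G.Strategy₂) (s : S) {n : ℕ}
    (f : (Finset.Iic n → S) → ℝ) :
    Integrable (fun ω : ℕ → S => f (Preorder.frestrictLe (π := fun _ => S) n ω))
      (G.playMeasure σ₁ σ₂ s) := by
  obtain ⟨C, hC⟩ := (Set.finite_range fun x => ‖f x‖).bddAbove
  exact Integrable.of_bound (measurable_history_fun f).aestronglyMeasurable C
    (ae_of_all _ fun ω => hC ⟨_, rfl⟩)

theorem safeExpect_zero (F : Set S) (σ₁ : G.Strategy₁) (σ₂ : G.Strategy₂) (s : S) {h : S → ℝ}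
    (h0 : ∀ t ∉ F, h t = 0) : G.safeExpect F σ₁ σ₂ s 0 h = h s := by
  classical
  unfold safeExpect
  have := G.integral_play_zero σ₁ σ₂ s fun t => (if t ∈ F then 1 else 0) * h t
  simp only [nonpos_iff_eq_zero, forall_eq]
  rw [this]
  by_cases hs : s ∈ F <;> simp [hs, h0]

open Classical in
-- Since `h` vanishes off `F`, safety at time `n + 1` need not be tested, which leaves an indicator
-- that depends on the past only.
theorem safeExpect_succ (F : Set S) (σ₁ : G.Strategy₁) (σ₂ : G.Strategy₂) (s : S) (n : ℕ)
    {h : S → ℝ} (h0 : ∀ t ∉ F, h t = 0) :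
    G.safeExpect F σ₁ σ₂ s (n + 1) h =
      ∫ ω, (if ∀ i ≤ n, ω i ∈ F then 1 else 0) *
        G.preMix h (ω n) (σ₁.1 (history ω n) (ω n)) (σ₂.1 (history ω n) (ω n))
        ∂G.playMeasure σ₁ σ₂ s := by
  refine Eq.trans ?_ (G.integral_play_succ σ₁ σ₂ s n
    (fun x => if ∀ i, ∀ hi : i ≤ n, x ⟨i, Finset.mem_Iic.2 hi⟩ ∈ F then 1 else 0) h)
  unfold safeExpect
  refine integral_congr_ae (ae_of_all _ fun ω => ?_)
  change _ = (if ∀ i ≤ n, ω i ∈ F then (1 : ℝ) else 0) * _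
  dsimp only
  by_cases h1 : ω (n + 1) ∈ F
  · have : (∀ i ≤ n + 1, ω i ∈ F) ↔ ∀ i ≤ n, ω i ∈ F :=
      ⟨fun h i hi => h i (by lia), fun h i hi => (Nat.le_succ_iff.1 hi).elim (h i) (· ▸ h1)⟩
    by_cases h2 : ∀ i ≤ n, ω i ∈ F
    · rw [if_pos h2, if_pos (this.2 h2)]
    · rw [if_neg h2, if_neg (mt this.1 h2)]
  · simp [h0 _ h1]

open Classical in
theorem integrable_safe_pre (F : Set S) (σ₁ : G.Strategy₁) (σ₂ : G.Strategy₂) (s : S) (n : ℕ)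
    (h : S → ℝ) :
    Integrable (fun ω : ℕ → S => (if ∀ i ≤ n, ω i ∈ F then (1 : ℝ) else 0) *
        G.preMix h (ω n) (σ₁.1 (history ω n) (ω n)) (σ₂.1 (history ω n) (ω n)))
      (G.playMeasure σ₁ σ₂ s) :=
  G.integrable_history_fun σ₁ σ₂ s (n := n) fun x =>
    (if ∀ i, ∀ hi : i ≤ n, x ⟨i, Finset.mem_Iic.2 hi⟩ ∈ F then 1 else 0) *
      G.preMix h (x ⟨n, Finset.mem_Iic.2 le_rfl⟩)
        (σ₁.1 (List.ofFn fun i : Fin n => x ⟨i, Finset.mem_Iic.2 i.2.le⟩)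
          (x ⟨n, Finset.mem_Iic.2 le_rfl⟩))
        (σ₂.1 (List.ofFn fun i : Fin n => x ⟨i, Finset.mem_Iic.2 i.2.le⟩)
          (x ⟨n, Finset.mem_Iic.2 le_rfl⟩))

open Classical in
theorem integrable_safe (F : Set S) (σ₁ : G.Strategy₁) (σ₂ : G.Strategy₂) (s : S) (n : ℕ)
    (h : S → ℝ) :
    Integrable (fun ω : ℕ → S => (if ∀ i ≤ n, ω i ∈ F then (1 : ℝ) else 0) * h (ω n))
      (G.playMeasure σ₁ σ₂ s) :=
  G.integrable_history_fun σ₁ σ₂ s (n := n) fun x =>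
    (if ∀ i, ∀ hi : i ≤ n, x ⟨i, Finset.mem_Iic.2 hi⟩ ∈ F then 1 else 0) *
      h (x ⟨n, Finset.mem_Iic.2 le_rfl⟩)

theorem safeExpect_mono (F : Set S) (σ₁ : G.Strategy₁) (σ₂ : G.Strategy₂) (s : S) (n : ℕ)
    {h h' : S → ℝ} (hh : ∀ t ∈ F, h t ≤ h' t) :
    G.safeExpect F σ₁ σ₂ s n h ≤ G.safeExpect F σ₁ σ₂ s n h' := by
  classical
  refine integral_mono (G.integrable_safe F σ₁ σ₂ s n h) (G.integrable_safe F σ₁ σ₂ s n h')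
    fun ω => ?_
  by_cases hω : ∀ i ≤ n, ω i ∈ F
  · simpa only [if_pos hω, one_mul] using hh _ (hω n le_rfl)
  · simp [hω]

theorem safeExpect_le_succ (F : Set S) (σ₁ : G.Strategy₁) (σ₂ : G.Strategy₂) (s : S) (n : ℕ)
    {h h' : S → ℝ} (h0 : ∀ t ∉ F, h' t = 0)
    (hh : ∀ w, ∀ t ∈ F, h t ≤ G.preMix h' t (σ₁.1 w t) (σ₂.1 w t)) :
    G.safeExpect F σ₁ σ₂ s n h ≤ G.safeExpect F σ₁ σ₂ s (n + 1) h' := by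
  classical
  refine le_trans ?_ (G.safeExpect_succ F σ₁ σ₂ s n h0).ge
  refine integral_mono (G.integrable_safe F σ₁ σ₂ s n h) (G.integrable_safe_pre F σ₁ σ₂ s n h')
    fun ω => ?_
  by_cases hω : ∀ i ≤ n, ω i ∈ F
  · simpa only [if_pos hω, one_mul] using hh (history ω n) _ (hω n le_rfl)
  · simp only [if_neg hω, zero_mul, le_refl]

theorem safeExpect_succ_le (F : Set S) (σ₁ : G.Strategy₁) (σ₂ : G.Strategy₂) (s : S) (n : ℕ)
    {h h' : S → ℝ} (h0 : ∀ t ∉ F, h' t = 0)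
    (hh : ∀ w, w.length = n → ∀ t ∈ F, G.preMix h' t (σ₁.1 w t) (σ₂.1 w t) ≤ h t) :
    G.safeExpect F σ₁ σ₂ s (n + 1) h' ≤ G.safeExpect F σ₁ σ₂ s n h := by
  classical
  refine (G.safeExpect_succ F σ₁ σ₂ s n h0).le.trans ?_
  refine integral_mono (G.integrable_safe_pre F σ₁ σ₂ s n h') (G.integrable_safe F σ₁ σ₂ s n h)
    fun ω => ?_
  by_cases hω : ∀ i ≤ n, ω i ∈ F
  · simpa only [if_pos hω, one_mul] using
      hh (history ω n) (by simp [history]) _ (hω n le_rfl)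
  · simp only [if_neg hω, zero_mul, le_refl]

theorem measurableSet_safe_upto (F : Set S) (n : ℕ) :
    MeasurableSet {ω : ℕ → S | ∀ i ≤ n, ω i ∈ F} := by
  have : {ω : ℕ → S | ∀ i ≤ n, ω i ∈ F} = ⋂ i, ⋂ (_ : i ≤ n), (fun ω => ω i) ⁻¹' F := by
    ext; simp
  rw [this]
  exact MeasurableSet.iInter fun i => MeasurableSet.iInter fun _ =>
    measurable_pi_apply i (MeasurableSet.of_discrete)

theorem safeExpect_one (F : Set S) (σ₁ : G.Strategy₁) (σ₂ : G.Strategy₂) (s : S) (n : ℕ) :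
    G.safeExpect F σ₁ σ₂ s n (fun _ => 1) =
      (G.playMeasure σ₁ σ₂ s).real {ω | ∀ i ≤ n, ω i ∈ F} := by
  classical
  unfold safeExpect
  rw [← integral_indicator_one (measurableSet_safe_upto F n)]
  congr 1 with ω
  simp [Set.indicator_apply]

theorem tendsto_safeExpect_one (F : Set S) (σ₁ : G.Strategy₁) (σ₂ : G.Strategy₂) (s : S) :
    Tendsto (fun n => G.safeExpect F σ₁ σ₂ s n fun _ => 1) atTop
      (𝓝 ((G.playMeasure σ₁ σ₂ s).real (SafePlays F))) := by
  have h : SafePlays F = ⋂ n, {ω : ℕ → S | ∀ i ≤ n, ω i ∈ F} := by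
    ext ω
    simp only [SafePlays, Set.mem_ofPred_eq, Set.mem_iInter]
    exact ⟨fun h n i _ => h i, fun h n => h n n le_rfl⟩
  simp only [safeExpect_one, h, Measure.real]
  refine (ENNReal.tendsto_toReal (measure_ne_top _ _)).comp (tendsto_measure_iInter_atTop
    (fun n => (measurableSet_safe_upto F n).nullMeasurableSet) ?_ ⟨0, measure_ne_top _ _⟩)
  intro m n hmn ω hω i hi
  exact hω i (hi.trans hmn)

end Play

/-! ### Bounds on the safety probability from one-step inequalities. -/

section Bounds

variable {S M : Type*} [Fintype S] [Fintype M] (G : ConcurrentGame S M)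

theorem prob_nonneg (σ₁ : G.Strategy₁) (σ₂ : G.Strategy₂) (Φ : Set (ℕ → S)) (s : S) :
    0 ≤ G.prob σ₁ σ₂ Φ s := measureReal_nonneg

theorem prob_le_one (σ₁ : G.Strategy₁) (σ₂ : G.Strategy₂) (Φ : Set (ℕ → S)) (s : S) :
    G.prob σ₁ σ₂ Φ s ≤ 1 :=
  letI : MeasurableSpace S := ⊤
  haveI : DiscreteMeasurableSpace S := ⟨fun _ => trivial⟩
  measureReal_le_one

/-- The expectation of `u` over safe prefixes is nondecreasing in time and bounded by the
probability of being safe so far, which tends to the probability of safety. -/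
theorem le_prob_safe {F : Set S} (σ₁ : G.Strategy₁) (σ₂ : G.Strategy₂) {u : S → ℝ}
    (h0 : ∀ s ∉ F, u s = 0) (h1 : ∀ s, u s ≤ 1)
    (hu : ∀ w, ∀ s ∈ F, u s ≤ G.preMix u s (σ₁.1 w s) (σ₂.1 w s)) (s : S) :
    u s ≤ G.prob σ₁ σ₂ (SafePlays F) s := by
  letI : MeasurableSpace S := ⊤
  haveI : DiscreteMeasurableSpace S := ⟨fun _ => trivial⟩
  have key : ∀ n, u s ≤ G.safeExpect F σ₁ σ₂ s n u := by
    intro n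
    induction n with
    | zero => exact (G.safeExpect_zero F σ₁ σ₂ s h0).ge
    | succ n ih => exact ih.trans (G.safeExpect_le_succ F σ₁ σ₂ s n h0 hu)
  exact ge_of_tendsto' (G.tendsto_safeExpect_one F σ₁ σ₂ s) fun n =>
    (key n).trans (G.safeExpect_mono F σ₁ σ₂ s n fun t _ => h1 t)

/-- Backward induction for player 2: `g n` bounds the probability of staying safe for `n` more
steps. The witness plays at each history a pure reply suited to the number of steps left. -/
theorem exists_prob_safe_le {F : Set S} (σ₁ : G.Strategy₁) {g : ℕ → S → ℝ}
    (h0 : ∀ n, ∀ s ∉ F, g n s = 0) (h1 : ∀ s ∈ F, 1 ≤ g 0 s)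
    (hg : ∀ n w, ∀ s ∈ F, ∃ b ∈ G.mov₂ s,
      G.preMix (g n) s (σ₁.1 w s) (PMF.pure b) ≤ g (n + 1) s) (n : ℕ) :
    ∃ σ₂ : G.Strategy₂, ∀ s, G.prob σ₁ σ₂ (SafePlays F) s ≤ g n s := by
  classical
  letI : MeasurableSpace S := ⊤
  haveI : DiscreteMeasurableSpace S := ⟨fun _ => trivial⟩
  have hb : ∀ n w s, ∃ b ∈ G.mov₂ s, s ∈ F →
      G.preMix (g n) s (σ₁.1 w s) (PMF.pure b) ≤ g (n + 1) s := by
    intro n w s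
    by_cases hs : s ∈ F
    · obtain ⟨b, hb, h⟩ := hg n w s hs
      exact ⟨b, hb, fun _ => h⟩
    · obtain ⟨b, hb⟩ := G.mov₂_nonempty s
      exact ⟨b, hb, fun h => absurd h hs⟩
  choose β hβ hβ' using hb
  -- After `j = w.length < n` earlier states, `n - j` steps remain, and the reply must bring `g (n -
  -- j - 1)` below `g (n - j)`. Beyond the horizon the truncated subtraction gives `0`, and the
  -- choice is immaterial.
  let σ₂ : G.Strategy₂ := ⟨fun w s => PMF.pure (β (n - w.length - 1) w s), by
    intro w s b h
    rw [← PMF.mem_support_iff, PMF.mem_support_pure_iff] at h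
    exact h ▸ hβ _ w s⟩
  refine ⟨σ₂, fun s => ?_⟩
  have key : ∀ j ≤ n, G.safeExpect F σ₁ σ₂ s j (g (n - j)) ≤ g n s := by
    intro j
    induction j with
    | zero => exact fun _ => (G.safeExpect_zero F σ₁ σ₂ s (h0 n)).le
    | succ j ih =>
      intro hj
      refine le_trans (G.safeExpect_succ_le F σ₁ σ₂ s j (h0 _) ?_) (ih (by lia))
      intro w hw t ht
      have := hβ' (n - w.length - 1) w t ht
      have e1 : n - w.length - 1 + 1 = n - j := by lia
      have e2 : n - (j + 1) = n - w.length - 1 := by lia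
      rw [e1] at this
      rw [e2]
      exact this
  have h2 := key n le_rfl
  rw [Nat.sub_self] at h2
  refine le_trans ?_ ((G.safeExpect_mono F σ₁ σ₂ s n h1).trans h2)
  rw [safeExpect_one]
  exact measureReal_mono fun ω hω i _ => hω i

end Bounds

/-! ### The one-step operators. -/

section OneStep

variable {S M : Type*} [Fintype S] [Fintype M] (G : ConcurrentGame S M)

theorem pure_mem_Sel₂ {s : S} {b : M} (hb : b ∈ G.mov₂ s) : PMF.pure b ∈ G.Sel₂ s := by
  intro c hc
  rw [← PMF.mem_support_iff, PMF.mem_support_pure_iff] at hc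
  exact hc ▸ hb

theorem le_preMix {v : S → ℝ} {s : S} {x : PMF M} {c : ℝ}
    (h : ∀ b ∈ G.mov₂ s, c ≤ G.preMix v s x (PMF.pure b)) {y : PMF M} (hy : y ∈ G.Sel₂ s) :
    c ≤ G.preMix v s x y := by
  rw [preMix_eq_sum_pure]
  calc c = ∑ b, (y b).toReal * c := by rw [← Finset.sum_mul, PMF.sum_toReal, one_mul]
    _ ≤ _ := by
      refine Finset.sum_le_sum fun b _ => ?_
      by_cases hb : y b = 0
      · simp [hb]
      · exact mul_le_mul_of_nonneg_left (h b (hy b hb)) ENNReal.toReal_nonneg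

instance (s : S) : Nonempty (G.Sel₂ s) :=
  let ⟨_, hb⟩ := G.mov₂_nonempty s
  ⟨⟨_, G.pure_mem_Sel₂ hb⟩⟩

/-- The expectation is affine in the distribution of player 2, so its infimum is attained at one of
the finitely many pure moves. -/
theorem exists_le_preMix_pure (v : S → ℝ) (s : S) (x : PMF M) :
    ∃ b ∈ G.mov₂ s, G.preMix v s x (PMF.pure b) = G.preSel v s x := by
  obtain ⟨b, hb, h⟩ := (G.mov₂ s).exists_min_image (fun b => G.preMix v s x (PMF.pure b))
    (G.mov₂_nonempty s)
  refine ⟨b, hb, le_antisymm (le_ciInf fun y => G.le_preMix h y.2) ?_⟩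
  exact ciInf_le ⟨G.preMix v s x (PMF.pure b), by
    rintro _ ⟨y, rfl⟩
    exact G.le_preMix h y.2⟩ (⟨_, G.pure_mem_Sel₂ hb⟩ : G.Sel₂ s)

theorem le_preSel_iff {v : S → ℝ} {s : S} {x : PMF M} {c : ℝ} :
    c ≤ G.preSel v s x ↔ ∀ b ∈ G.mov₂ s, c ≤ G.preMix v s x (PMF.pure b) := by
  obtain ⟨b, hb, h⟩ := (G.mov₂ s).exists_min_image (fun b => G.preMix v s x (PMF.pure b))
    (G.mov₂_nonempty s)
  constructor
  · intro hc b' hb'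
    refine hc.trans (ciInf_le ⟨G.preMix v s x (PMF.pure b), ?_⟩
      (⟨_, G.pure_mem_Sel₂ hb'⟩ : G.Sel₂ s))
    rintro _ ⟨y, rfl⟩
    exact G.le_preMix h y.2
  · exact fun hc => le_ciInf fun y => G.le_preMix hc y.2

theorem preSel_le_preMix (v : S → ℝ) {s : S} (x : PMF M) {b : M} (hb : b ∈ G.mov₂ s) :
    G.preSel v s x ≤ G.preMix v s x (PMF.pure b) :=
  G.le_preSel_iff.1 le_rfl b hb

theorem preSel_mono {u v : S → ℝ} (h : ∀ t, u t ≤ v t) (s : S) (x : PMF M) :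
    G.preSel u s x ≤ G.preSel v s x :=
  G.le_preSel_iff.2 fun _ hb => (G.preSel_le_preMix u x hb).trans (G.preMix_mono h s x _)

theorem preSel_const (c : ℝ) (s : S) (x : PMF M) : G.preSel (fun _ => c) s x = c := by
  obtain ⟨b, -, h⟩ := G.exists_le_preMix_pure (fun _ => c) s x
  rw [← h, preMix_const]

theorem preSel_le {v : S → ℝ} {c : ℝ} (h : ∀ t, v t ≤ c) (s : S) (x : PMF M) :
    G.preSel v s x ≤ c :=
  (G.preSel_mono h s x).trans (G.preSel_const c s x).le

theorem le_preSel {v : S → ℝ} {c : ℝ} (h : ∀ t, c ≤ v t) (s : S) (x : PMF M) :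
    c ≤ G.preSel v s x :=
  (G.preSel_const c s x).ge.trans (G.preSel_mono h s x)

variable {Adm : S → Set (PMF M)}

theorem preSel_le_preSup (v : S → ℝ) {s : S} {x : PMF M} (hx : x ∈ Adm s) :
    G.preSel v s x ≤ G.preSup Adm v s := by
  obtain ⟨c, hc⟩ := (Set.finite_range v).bddAbove
  refine le_ciSup (f := fun x : Adm s => G.preSel v s x) ⟨c, ?_⟩ ⟨x, hx⟩
  rintro _ ⟨y, rfl⟩
  exact G.preSel_le (fun t => hc ⟨t, rfl⟩) s y

theorem preSup_le {v : S → ℝ} {s : S} (hne : (Adm s).Nonempty) {c : ℝ}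
    (h : ∀ x ∈ Adm s, G.preSel v s x ≤ c) : G.preSup Adm v s ≤ c :=
  haveI := hne.to_subtype
  ciSup_le fun x => h x x.2

theorem preSup_mono {u v : S → ℝ} {s : S} (hne : (Adm s).Nonempty) (h : ∀ t, u t ≤ v t) :
    G.preSup Adm u s ≤ G.preSup Adm v s :=
  G.preSup_le hne fun x hx => (G.preSel_mono h s x).trans (G.preSel_le_preSup v hx)

theorem tendsto_preMix_pure {v : ℕ → S → ℝ} {v' : S → ℝ} (hv : ∀ t, Tendsto (v · t) atTop (𝓝 (v' t)))
    {x : ℕ → PMF M} {x' : PMF M} (hx : ∀ a, Tendsto (fun n => (x n a).toReal) atTop (𝓝 (x' a).toReal))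
    (s : S) (b : M) :
    Tendsto (fun n => G.preMix (v n) s (x n) (PMF.pure b)) atTop
      (𝓝 (G.preMix v' s x' (PMF.pure b))) := by
  simp only [preMix_pure]
  exact tendsto_finsetSum _ fun a _ => (hx a).mul
    (tendsto_finsetSum _ fun t _ => (hv t).const_mul _)

end OneStep

/-! ### Finite-horizon values, their limit, and optimal memoryless strategies. -/

section Horizon

variable {S M : Type*} [Fintype S] [Fintype M] (G : ConcurrentGame S M)

open Classical in
/-- The best probability of staying in `F` for `n` steps when player 1 uses selectors from `Adm`. -/
def horizonVal (Adm : S → Set (PMF M)) (F : Set S) : ℕ → S → ℝ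
  | 0 => fun s => if s ∈ F then 1 else 0
  | n + 1 => fun s => if s ∈ F then G.preSup Adm (horizonVal Adm F n) s else 0

/-- The limit of the values for finite horizons. -/
def limitVal (Adm : S → Set (PMF M)) (F : Set S) (s : S) : ℝ := ⨅ n, G.horizonVal Adm F n s

/-- Sequences in `Adm s` have subsequences that converge in `Adm s`. -/
def SeqCompactSel (Adm : S → Set (PMF M)) : Prop :=
  ∀ s, ∀ x : ℕ → PMF M, (∀ n, x n ∈ Adm s) → ∃ z ∈ Adm s, ∃ φ : ℕ → ℕ, StrictMono φ ∧
    ∀ a, Tendsto (fun n => (x (φ n) a).toReal) atTop (𝓝 (z a).toReal)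

variable {G} {Adm : S → Set (PMF M)} {F : Set S}

theorem horizonVal_of_notMem {s : S} (hs : s ∉ F) (n : ℕ) : G.horizonVal Adm F n s = 0 := by
  cases n <;> simp [horizonVal, hs]

theorem horizonVal_succ {s : S} (hs : s ∈ F) (n : ℕ) :
    G.horizonVal Adm F (n + 1) s = G.preSup Adm (G.horizonVal Adm F n) s := by
  simp [horizonVal, hs]

theorem horizonVal_mem_Icc (hne : ∀ s, (Adm s).Nonempty) (n : ℕ) (s : S) :
    G.horizonVal Adm F n s ∈ Set.Icc (0 : ℝ) 1 := by
  induction n generalizing s with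
  | zero => by_cases hs : s ∈ F <;> simp [horizonVal, hs]
  | succ n ih =>
    by_cases hs : s ∈ F
    · rw [horizonVal_succ hs]
      obtain ⟨x, hx⟩ := hne s
      exact ⟨(G.le_preSel (fun t => (ih t).1) s x).trans (G.preSel_le_preSup _ hx),
        G.preSup_le (hne s) fun x _ => G.preSel_le (fun t => (ih t).2) s x⟩
    · simp [horizonVal, hs]

theorem horizonVal_succ_le (hne : ∀ s, (Adm s).Nonempty) (n : ℕ) (s : S) :
    G.horizonVal Adm F (n + 1) s ≤ G.horizonVal Adm F n s := by
  by_cases hs : s ∈ F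
  · induction n generalizing s with
    | zero => exact (horizonVal_mem_Icc hne _ s).2.trans (by simp [horizonVal, hs])
    | succ n ih =>
      rw [horizonVal_succ hs, horizonVal_succ hs]
      refine G.preSup_mono (hne s) fun t => ?_
      by_cases ht : t ∈ F
      · exact ih t ht
      · simp [horizonVal_of_notMem ht]
  · simp [horizonVal_of_notMem hs]

theorem bddBelow_horizonVal (hne : ∀ s, (Adm s).Nonempty) (s : S) :
    BddBelow (Set.range fun n => G.horizonVal Adm F n s) :=
  ⟨0, by rintro _ ⟨n, rfl⟩; exact (horizonVal_mem_Icc hne n s).1⟩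

theorem tendsto_horizonVal (hne : ∀ s, (Adm s).Nonempty) (s : S) :
    Tendsto (fun n => G.horizonVal Adm F n s) atTop (𝓝 (G.limitVal Adm F s)) :=
  tendsto_atTop_ciInf (antitone_nat_of_succ_le fun n => horizonVal_succ_le hne n s)
    (bddBelow_horizonVal hne s)

theorem limitVal_le (hne : ∀ s, (Adm s).Nonempty) (n : ℕ) (s : S) :
    G.limitVal Adm F s ≤ G.horizonVal Adm F n s :=
  ciInf_le (bddBelow_horizonVal hne s) n

theorem limitVal_of_notMem {s : S} (hs : s ∉ F) : G.limitVal Adm F s = 0 := by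
  simp [limitVal, horizonVal_of_notMem hs]

theorem limitVal_le_one (hne : ∀ s, (Adm s).Nonempty) (s : S) : G.limitVal Adm F s ≤ 1 :=
  (limitVal_le hne 0 s).trans (horizonVal_mem_Icc hne 0 s).2

theorem preSup_limitVal_le (hne : ∀ s, (Adm s).Nonempty) {s : S} (hs : s ∈ F) :
    G.preSup Adm (G.limitVal Adm F) s ≤ G.limitVal Adm F s := by
  refine le_ciInf fun n => ?_
  refine le_trans ?_ (horizonVal_succ_le hne n s)
  rw [horizonVal_succ hs]
  exact G.preSup_mono (hne s) fun t => limitVal_le hne n t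

/-- Take nearly optimal selectors for each horizon, pass to a convergent subsequence, and let the
horizon tend to infinity in the inequality for each of the pure replies. -/
theorem exists_limitVal_le_preSel (hne : ∀ s, (Adm s).Nonempty) (hc : SeqCompactSel Adm) {s : S}
    (hs : s ∈ F) : ∃ x ∈ Adm s, G.limitVal Adm F s ≤ G.preSel (G.limitVal Adm F) s x := by
  have hx : ∀ n : ℕ, ∃ x ∈ Adm s, G.horizonVal Adm F (n + 1) s - 1 / ((n : ℝ) + 1) <
      G.preSel (G.horizonVal Adm F n) s x := by
    intro n
    by_contra! h
    have h1 := G.preSup_le (hne s) h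
    rw [← horizonVal_succ hs] at h1
    have : (0 : ℝ) < 1 / ((n : ℝ) + 1) := by positivity
    linarith
  choose x hx hlt using hx
  obtain ⟨z, hz, φ, hφ, hlim⟩ := hc s x hx
  refine ⟨z, hz, G.le_preSel_iff.2 fun b hb => ?_⟩
  have l1 := G.tendsto_preMix_pure (v := fun n => G.horizonVal Adm F (φ n))
    (fun t => (tendsto_horizonVal hne t).comp hφ.tendsto_atTop) hlim s b
  have l2 : Tendsto (fun n => G.horizonVal Adm F (n + 1) s - 1 / ((n : ℝ) + 1)) atTop
      (𝓝 (G.limitVal Adm F s - 0)) :=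
    ((tendsto_add_atTop_iff_nat 1).2 (tendsto_horizonVal hne s)).sub
      tendsto_one_div_add_atTop_nhds_zero_nat
  rw [sub_zero] at l2
  exact le_of_tendsto_of_tendsto' (l2.comp hφ.tendsto_atTop) l1 fun n =>
    (hlt (φ n)).le.trans (G.preSel_le_preMix _ _ hb)

instance : Nonempty G.Strategy₂ := by
  choose b hb using G.mov₂_nonempty
  exact ⟨⟨fun _ s => PMF.pure (b s), fun _ s => G.pure_mem_Sel₂ (hb s)⟩⟩

instance : Nonempty G.Strategy₁ := ⟨memoryless G.uniformSelector⟩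

theorem bddBelow_prob (σ₁ : G.Strategy₁) (Φ : Set (ℕ → S)) (s : S) :
    BddBelow (Set.range fun σ₂ : G.Strategy₂ => G.prob σ₁ σ₂ Φ s) :=
  ⟨0, by rintro _ ⟨σ₂, rfl⟩; exact G.prob_nonneg _ _ _ _⟩

theorem stratVal_nonneg (σ₁ : G.Strategy₁) (Φ : Set (ℕ → S)) (s : S) : 0 ≤ G.stratVal σ₁ Φ s :=
  le_ciInf fun _ => G.prob_nonneg _ _ _ _

theorem stratVal_le_one (σ₁ : G.Strategy₁) (Φ : Set (ℕ → S)) (s : S) : G.stratVal σ₁ Φ s ≤ 1 :=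
  let ⟨σ₂⟩ : Nonempty G.Strategy₂ := inferInstance
  (ciInf_le (bddBelow_prob σ₁ Φ s) σ₂).trans (G.prob_le_one _ _ _ _)

theorem bddAbove_stratVal (Φ : Set (ℕ → S)) (s : S) :
    BddAbove (Set.range fun σ₁ : G.Strategy₁ => G.stratVal σ₁ Φ s) :=
  ⟨1, by rintro _ ⟨σ₁, rfl⟩; exact stratVal_le_one _ _ _⟩

theorem stratVal_le_val (σ₁ : G.Strategy₁) (Φ : Set (ℕ → S)) (s : S) :
    G.stratVal σ₁ Φ s ≤ G.val Φ s :=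
  le_ciSup (bddAbove_stratVal Φ s) σ₁

theorem val_le_one (Φ : Set (ℕ → S)) (s : S) : G.val Φ s ≤ 1 :=
  ciSup_le fun σ₁ => stratVal_le_one σ₁ Φ s

/-- Memory does not help: at every history player 2 can answer with a one-step minimizer for the
remaining horizon, so each finite-horizon value bounds what `σ₁` guarantees. -/
theorem stratVal_le_limitVal (σ₁ : G.Strategy₁)
    (hσ : ∀ w s, σ₁.1 w s ∈ Adm s) (s : S) :
    G.stratVal σ₁ (SafePlays F) s ≤ G.limitVal Adm F s := by
  refine le_ciInf fun n => ?_
  obtain ⟨σ₂, h⟩ := G.exists_prob_safe_le (F := F) σ₁ (g := G.horizonVal Adm F)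
    (fun n s hs => horizonVal_of_notMem hs n) (fun s hs => by simp [horizonVal, hs])
    (fun n w s hs => by
      obtain ⟨b, hb, hbe⟩ := G.exists_le_preMix_pure (G.horizonVal Adm F n) s (σ₁.1 w s)
      refine ⟨b, hb, hbe.le.trans ?_⟩
      rw [horizonVal_succ hs]
      exact G.preSel_le_preSup _ (hσ w s)) n
  exact (ciInf_le (bddBelow_prob _ _ s) σ₂).trans (h s)

/-- The submartingale test in the form used for all lower bounds below. Against a memoryless
strategy the one-step inequality passes from pure replies to arbitrary strategies of player 2. -/
theorem le_selVal (γ : G.Selector₁) {u : S → ℝ} (h0 : ∀ s ∉ F, u s = 0) (h1 : ∀ s, u s ≤ 1)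
    (hu : ∀ s ∈ F, u s ≤ G.preSel u s (γ.1 s)) (s : S) : u s ≤ selVal F γ s :=
  le_ciInf fun σ₂ => G.le_prob_safe (memoryless γ) σ₂ h0 h1
    (fun w t ht => G.le_preMix (G.le_preSel_iff.1 (hu t ht)) (σ₂.2 w t)) s

theorem exists_selVal_eq_limitVal (hne : ∀ s, (Adm s).Nonempty) (hsub : ∀ s, Adm s ⊆ G.Sel₁ s)
    (hc : SeqCompactSel Adm) :
    ∃ ξ : G.Selector₁, (∀ s, ξ.1 s ∈ Adm s) ∧ selVal F ξ = G.limitVal Adm F := by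
  have h : ∀ s, ∃ x ∈ Adm s, s ∈ F → G.limitVal Adm F s ≤ G.preSel (G.limitVal Adm F) s x := by
    intro s
    by_cases hs : s ∈ F
    · obtain ⟨x, hx, h⟩ := exists_limitVal_le_preSel hne hc hs
      exact ⟨x, hx, fun _ => h⟩
    · obtain ⟨x, hx⟩ := hne s
      exact ⟨x, hx, fun h => absurd h hs⟩
  choose x hx hle using h
  let ξ : G.Selector₁ := ⟨x, fun s => hsub s (hx s)⟩
  have h1 : ∀ s, selVal F ξ s ≤ G.limitVal Adm F s :=
    stratVal_le_limitVal (memoryless ξ) fun _ s => hx s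
  have h2 : ∀ s, G.limitVal Adm F s ≤ selVal F ξ s :=
    le_selVal ξ (fun s hs => limitVal_of_notMem hs) (limitVal_le_one hne) hle
  exact ⟨ξ, hx, funext fun s => le_antisymm (h1 s) (h2 s)⟩

theorem seqCompactSel_singleton (f : S → PMF M) : SeqCompactSel fun s => ({f s} : Set (PMF M)) := by
  intro s x hx
  refine ⟨f s, rfl, id, strictMono_id, fun a => ?_⟩
  have : x = fun _ => f s := funext hx
  subst this
  exact tendsto_const_nhds

/-- With only `γ` admissible, the general theory of `limitVal` describes the valuation of the single
selector `γ`. -/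
theorem selVal_eq_limitVal (γ : G.Selector₁) : selVal F γ = G.limitVal (fun s => {γ.1 s}) F := by
  obtain ⟨ξ, hξ, h⟩ := exists_selVal_eq_limitVal (G := G) (F := F) (Adm := fun s => {γ.1 s})
    (fun s => Set.singleton_nonempty _) (fun s => Set.singleton_subset_iff.2 (γ.2 s))
    (seqCompactSel_singleton _)
  have : ξ = γ := Subtype.ext (funext hξ)
  rw [← h, this]

theorem selVal_nonneg (γ : G.Selector₁) (s : S) : 0 ≤ selVal F γ s := stratVal_nonneg _ _ _

theorem selVal_le_one (γ : G.Selector₁) (s : S) : selVal F γ s ≤ 1 := stratVal_le_one _ _ _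

theorem selVal_le_val (γ : G.Selector₁) (s : S) : selVal F γ s ≤ G.val (SafePlays F) s :=
  stratVal_le_val _ _ _

theorem selVal_of_notMem (γ : G.Selector₁) {s : S} (hs : s ∉ F) : selVal F γ s = 0 := by
  rw [selVal_eq_limitVal, limitVal_of_notMem hs]

theorem preSel_selVal (γ : G.Selector₁) {s : S} (hs : s ∈ F) :
    G.preSel (selVal F γ) s (γ.1 s) = selVal F γ s := by
  have hne : ∀ s, ({γ.1 s} : Set (PMF M)).Nonempty := fun s => Set.singleton_nonempty _
  have hc := seqCompactSel_singleton γ.1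
  rw [selVal_eq_limitVal]
  refine le_antisymm ((G.preSel_le_preSup _ rfl).trans (preSup_limitVal_le hne hs)) ?_
  obtain ⟨x, hx, h⟩ := exists_limitVal_le_preSel (F := F) (G := G) hne hc hs
  rwa [show x = γ.1 s from hx] at h

theorem selVal_le_preMix (γ : G.Selector₁) {s : S} (hs : s ∈ F) {b : M} (hb : b ∈ G.mov₂ s) :
    selVal F γ s ≤ G.preMix (selVal F γ) s (γ.1 s) (PMF.pure b) :=
  (preSel_selVal γ hs).ge.trans (G.preSel_le_preMix _ _ hb)

end Horizon

/-! ### Existence of optimal selectors, and states of value 1. -/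

section Optimal

variable {S M : Type*} [Fintype S] [Fintype M] {G : ConcurrentGame S M} {F : Set S}

/-- The distribution with given real probabilities. -/
def _root_.PMF.ofReal {α : Type*} [Fintype α] (f : α → ℝ) (h0 : ∀ a, 0 ≤ f a) (h1 : ∑ a, f a = 1) :
    PMF α :=
  PMF.ofFintype (fun a => ENNReal.ofReal (f a)) (by
    rw [← ENNReal.ofReal_sum_of_nonneg fun a _ => h0 a, h1, ENNReal.ofReal_one])

theorem _root_.PMF.toReal_ofReal {α : Type*} [Fintype α] (f : α → ℝ) (h0 : ∀ a, 0 ≤ f a)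
    (h1 : ∑ a, f a = 1) (a : α) : (PMF.ofReal f h0 h1 a).toReal = f a :=
  ENNReal.toReal_ofReal (h0 a)

theorem _root_.PMF.toReal_ne_zero_iff {α : Type*} (p : PMF α) (a : α) :
    (p a).toReal ≠ 0 ↔ p a ≠ 0 := by
  simp [ENNReal.toReal_eq_zero_iff, p.apply_ne_top a]

/-- Compactness of the simplex. Moves that are unavailable have probability zero along the sequence,
hence also in the limit. -/
theorem seqCompactSel_Sel₁ : SeqCompactSel G.Sel₁ := by
  intro s x hx
  obtain ⟨z, hz, φ, hφ, hlim⟩ := (isCompact_stdSimplex ℝ M).tendsto_subseq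
    (x := fun n a => (x n a).toReal) fun n => ⟨fun a => ENNReal.toReal_nonneg, (x n).sum_toReal⟩
  rw [tendsto_pi_nhds] at hlim
  refine ⟨PMF.ofReal z hz.1 hz.2, fun a ha => ?_, φ, hφ, fun a => ?_⟩
  · by_contra hna
    rw [← PMF.toReal_ne_zero_iff, PMF.toReal_ofReal] at ha
    refine ha (tendsto_nhds_unique (hlim a) ?_)
    have : ∀ n, x n a = 0 := fun n => by
      by_contra h
      exact hna (hx n a h)
    simp [this]
  · rw [PMF.toReal_ofReal]
    exact hlim a

theorem exists_selVal_eq_val (G : ConcurrentGame S M) (F : Set S) :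
    ∃ ξ : G.Selector₁, selVal F ξ = G.val (SafePlays F) := by
  have hne : ∀ s, (G.Sel₁ s).Nonempty := fun s => ⟨_, G.uniformSelector.2 s⟩
  obtain ⟨ξ, -, h⟩ := exists_selVal_eq_limitVal (G := G) (F := F) hne
    (fun s => subset_rfl) seqCompactSel_Sel₁
  refine ⟨ξ, funext fun s => le_antisymm (selVal_le_val ξ s) ?_⟩
  rw [h]
  exact ciSup_le fun σ₁ => stratVal_le_limitVal σ₁ σ₁.2 s

theorem almostSure_subset : G.almostSure F ⊆ F := by
  intro s hs
  by_contra hsF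
  obtain ⟨ξ, h⟩ := exists_selVal_eq_val G F
  have := congrFun h s
  rw [selVal_of_notMem ξ hsF, show G.val (SafePlays F) s = 1 from hs] at this
  exact zero_ne_one this

/-- A set of safe states that `γ` never leaves is winning. -/
theorem selVal_eq_one_of_closed (γ : G.Selector₁) {Z : Set S} (hZ : Z ⊆ F)
    (hcl : ∀ s ∈ Z, ∀ b ∈ G.mov₂ s, ∀ a, γ.1 s a ≠ 0 → ∀ t, G.trans s a b t ≠ 0 → t ∈ Z)
    {s : S} (hs : s ∈ Z) : selVal F γ s = 1 := by
  classical
  refine le_antisymm (selVal_le_one γ s) ?_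
  have h := le_selVal (F := F) γ (u := fun s => if s ∈ Z then 1 else 0)
    (fun s hs => if_neg fun h => hs (hZ h)) (fun s => by split_ifs <;> norm_num) ?_ s
  · simpa [hs] using h
  intro s _
  by_cases hs : s ∈ Z
  · refine G.le_preSel_iff.2 fun b hb => ?_
    rw [if_pos hs, preMix_pure]
    refine ((γ.1 s).sum_toReal.symm.trans (Finset.sum_congr rfl fun a _ => ?_)).le
    by_cases ha : γ.1 s a = 0
    · simp [ha]
    · have : ∑ t, (G.trans s a b t).toReal * (if t ∈ Z then 1 else 0) = 1 := by
        refine (Finset.sum_congr rfl fun t _ => ?_).trans (G.trans s a b).sum_toReal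
        by_cases ht : G.trans s a b t = 0
        · simp [ht]
        · simp [hcl s hs b hb a ha t ht]
      rw [this, mul_one]
  · rw [if_neg hs]
    exact G.le_preSel (fun t => by split_ifs <;> norm_num) s _

/-- If `c` is the maximum of `v` and also its one-step expectation, then `v` equals `c` at all
successors. -/
theorem eq_of_preMix_pure_eq {v : S → ℝ} {c : ℝ} (hv : ∀ t, v t ≤ c) {s : S} {x : PMF M} {b : M}
    (h : c ≤ G.preMix v s x (PMF.pure b)) {a : M} (ha : x a ≠ 0) {t : S}
    (ht : G.trans s a b t ≠ 0) : v t = c := by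
  refine le_antisymm (hv t) (le_of_not_gt fun hlt => ?_)
  refine absurd h (not_le.2 ?_)
  have hin : ∀ a, ∑ t, (G.trans s a b t).toReal * v t ≤ c := fun a =>
    calc _ ≤ ∑ t, (G.trans s a b t).toReal * c :=
          Finset.sum_le_sum fun t _ => mul_le_mul_of_nonneg_left (hv t) ENNReal.toReal_nonneg
      _ = c := by rw [← Finset.sum_mul, PMF.sum_toReal, one_mul]
  rw [preMix_pure]
  calc _ < ∑ a, (x a).toReal * c := by
        refine Finset.sum_lt_sum (fun a _ => mul_le_mul_of_nonneg_left (hin a)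
          ENNReal.toReal_nonneg) ⟨a, Finset.mem_univ _, ?_⟩
        refine mul_lt_mul_of_pos_left ?_
          (ENNReal.toReal_nonneg.lt_of_ne' ((PMF.toReal_ne_zero_iff _ _).2 ha))
        calc _ < ∑ t, (G.trans s a b t).toReal * c := by
              refine Finset.sum_lt_sum (fun t _ => mul_le_mul_of_nonneg_left (hv t)
                ENNReal.toReal_nonneg) ⟨t, Finset.mem_univ _, ?_⟩
              exact mul_lt_mul_of_pos_left hlt
                (ENNReal.toReal_nonneg.lt_of_ne' ((PMF.toReal_ne_zero_iff _ _).2 ht))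
          _ = c := by rw [← Finset.sum_mul, PMF.sum_toReal, one_mul]
    _ = c := by rw [← Finset.sum_mul, PMF.sum_toReal, one_mul]

/-- The valuation is at most `1` everywhere, so an expectation of at least `1` forces the value `1`
at every possible successor. -/
theorem selVal_succ_eq_one (γ : G.Selector₁) {s : S} (hs : selVal F γ s = 1) {b : M}
    (hb : b ∈ G.mov₂ s) {a : M} (ha : γ.1 s a ≠ 0) {t : S} (ht : G.trans s a b t ≠ 0) :
    selVal F γ t = 1 := by
  have hsF : s ∈ F := by
    by_contra h
    rw [selVal_of_notMem γ h] at hs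
    exact zero_ne_one hs
  exact eq_of_preMix_pure_eq (selVal_le_one γ) (hs ▸ selVal_le_preMix γ hsF hb) ha ht

theorem selVal_eq_one_of_absorbing (γ : G.Selector₁) {s : S} (hs : s ∈ F) (ha : G.Absorbing s) :
    selVal F γ s = 1 := by
  refine selVal_eq_one_of_closed γ (Z := {s}) (Set.singleton_subset_iff.2 hs) ?_ rfl
  rintro s rfl b hb a h t ht
  have h1 := (PMF.apply_eq_one_iff _ _).1 (ha a (γ.2 _ a h) b hb)
  have : t ∈ (G.trans s a b).support := ht
  rwa [h1] at this

end Optimal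

theorem _root_.PMF.pure_apply_ne_zero_iff {α : Type*} {a b : α} : PMF.pure a b ≠ 0 ↔ b = a := by
  rw [← PMF.mem_support_iff, PMF.mem_support_pure_iff]

/-! ### Pure memoryless almost-sure winning strategies. -/

section PureWinning

variable {S M : Type*} [Fintype S] [Fintype M]

/-- Every move in the support of an optimal selector keeps the play among the states of value 1.
Choosing one such move at each state therefore makes that set closed, and closed safe sets are
winning. -/
theorem exists_pure_winning (G : ConcurrentGame S M) (F : Set S) :
    ∃ ξ : G.Selector₁, IsPure ξ ∧ ∀ s ∈ G.almostSure F, selVal F ξ s = 1 := by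
  obtain ⟨ξ, hξ⟩ := exists_selVal_eq_val G F
  choose a ha using fun s => (ξ.1 s).support_nonempty
  let ζ : G.Selector₁ := ⟨fun s => PMF.pure (a s), fun s c hc =>
    PMF.pure_apply_ne_zero_iff.1 hc ▸ ξ.2 s _ (ha s)⟩
  refine ⟨ζ, fun s => ⟨a s, rfl⟩, fun s hs =>
    selVal_eq_one_of_closed ζ almostSure_subset ?_ hs⟩
  intro s hs b hb c hc t ht
  obtain rfl : c = a s := PMF.pure_apply_ne_zero_iff.1 hc
  have h1 : selVal F ξ s = 1 := (congrFun hξ s).trans hs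
  exact (congrFun hξ t).symm.trans (selVal_succ_eq_one ξ h1 hb (ha s) ht)

theorem mem_almostSure_of_selVal {G : ConcurrentGame S M} {F : Set S} {ξ : G.Selector₁} {s : S}
    (h : selVal F ξ s = 1) : s ∈ G.almostSure F :=
  le_antisymm (val_le_one _ s) (h ▸ selVal_le_val ξ s)

theorem selVal_lt_one {G : ConcurrentGame S M} {F : Set S} (ξ : G.Selector₁) {s : S}
    (hs : s ∉ G.almostSure F) : selVal F ξ s < 1 :=
  (selVal_le_one ξ s).lt_of_ne fun h => hs (mem_almostSure_of_selVal h)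

end PureWinning

/-! ### The turn-based reduction. -/

section Reduction

variable {S M : Type*} [Fintype S] [Fintype M] {G : ConcurrentGame S M}
  {Adm : S → Set (PMF M)} {v : S → ℝ} {F : Set S}

theorem mem_tbSucc {x y z : G.TBState Adm v} (h : TBEdge G x.1 y.1) :
    z ∈ G.tbSucc Adm v x ↔ TBEdge G x.1 z.1 := by
  classical
  unfold tbSucc
  rw [if_pos ⟨y, by simpa using h⟩]
  simp

theorem tbGame_trans_ne_zero_iff {x t : G.TBState Adm v} (hx : x.1.owner = .random)
    (c d : G.TBState Adm v) :
    (G.tbGame Adm v).trans x c d t ≠ 0 ↔ t ∈ G.tbSucc Adm v x := by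
  have h : (G.tbGame Adm v).trans x c d = (G.tbReduction Adm v).trans x := by
    simp [TurnBasedGame.toConcurrent, tbReduction, hx]
  rw [h]
  exact (G.tbReduction Adm v).trans_pos_iff x hx t

theorem mem_supp {x : PMF M} {a : M} : a ∈ supp x ↔ x a ≠ 0 := by simp [supp]

theorem exists_mem_mov₁_pair {s : S} {x : PMF M} (hx : x ∈ G.OptSel Adm v s) :
    ∃ y ∈ (G.tbGame Adm v).mov₁ (G.tbBase Adm v s),
      y.1 = .pair s (supp x) (G.countOpt Adm v s x) := by
  let y : G.TBState Adm v := ⟨.pair s (supp x) (G.countOpt Adm v s x), x, hx, rfl, rfl⟩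
  have he : TBEdge G (G.tbBase Adm v s).1 y.1 := rfl
  exact ⟨y, (mem_tbSucc he).2 he, rfl⟩

theorem exists_optSel_of_mem_mov₁ {s : S} (hne : (G.OptSel Adm v s).Nonempty)
    {y : G.TBState Adm v} (hy : y ∈ (G.tbGame Adm v).mov₁ (G.tbBase Adm v s)) :
    ∃ x ∈ G.OptSel Adm v s, y.1 = .pair s (supp x) (G.countOpt Adm v s x) := by
  obtain ⟨x, hx⟩ := hne
  let z : G.TBState Adm v := ⟨.pair s (supp x) (G.countOpt Adm v s x), x, hx, rfl, rfl⟩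
  have he : TBEdge G (G.tbBase Adm v s).1 z.1 := rfl
  have hy' : TBEdge G (G.tbBase Adm v s).1 y.1 := (mem_tbSucc he).1 hy
  obtain ⟨nm, hnm⟩ := y
  cases nm with
  | base => exact absurd hy' id
  | act => exact absurd hy' id
  | pair s' A B =>
    obtain rfl : s' = s := hy'
    obtain ⟨x', hx', h1, h2⟩ := hnm
    dsimp only at h1 h2
    subst h1 h2
    exact ⟨x', hx', rfl⟩

/-- One step of the original game is three steps of the reduction, from `s` through `(s, A, B)` and
`(s, A, b)` to `t`; value 1 under `σ` is passed along each of them. -/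
theorem TBWinning.succ_mem {σ : (G.tbGame Adm v).Selector₁} (hσ : G.TBWinning Adm v F σ)
    {s : S} (hs : G.tbBase Adm v s ∈ G.tbAlmostSure Adm v F) {A B : Finset M}
    {y : G.TBState Adm v} (hy : y.1 = .pair s A B)
    (hσy : σ.1 (G.tbBase Adm v s) = PMF.pure y) {a b : M} (ha : a ∈ A) (hb : b ∈ B) {t : S}
    (ht : G.trans s a b t ≠ 0) : G.tbBase Adm v t ∈ G.tbAlmostSure Adm v F := by
  obtain ⟨y, hyv⟩ := y
  obtain rfl : y = .pair s A B := hy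
  have hyv' : (A, B) ∈ G.OptSelCount Adm v s := hyv
  let z : G.TBState Adm v := ⟨.act s A b, B, hyv', hb⟩
  have h1 := hσ.2 _ hs
  have h2 : selVal (G.tbSafe Adm v F) σ ⟨.pair s A B, hyv⟩ = 1 :=
    selVal_succ_eq_one σ h1 (b := G.tbBase Adm v s) (Finset.mem_singleton_self _)
      (a := ⟨.pair s A B, hyv⟩) (by rw [hσy]; exact PMF.pure_apply_ne_zero_iff.2 rfl)
      (PMF.pure_apply_ne_zero_iff.2 rfl)
  obtain ⟨c, hc⟩ := (σ.1 ⟨.pair s A B, hyv⟩).support_nonempty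
  have e1 : TBEdge G (.pair s A B) z.1 := ⟨rfl, rfl, hb⟩
  have h3 : selVal (G.tbSafe Adm v F) σ z = 1 :=
    selVal_succ_eq_one σ h2 (b := z) ((mem_tbSucc (x := ⟨.pair s A B, hyv⟩) e1).2 e1) hc
      (PMF.pure_apply_ne_zero_iff.2 rfl)
  obtain ⟨d, hd⟩ := (σ.1 z).support_nonempty
  have e2 : TBEdge G z.1 (G.tbBase Adm v t).1 := ⟨a, ha, ht⟩
  refine mem_almostSure_of_selVal (ξ := σ) (selVal_succ_eq_one σ h3 (b := z)
    (Finset.mem_singleton_self _) hd ?_)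
  exact (tbGame_trans_ne_zero_iff (x := z) rfl d z).2 ((mem_tbSucc e2).2 e2)

/-- Safe states that are closed under the support and the counter-optimal moves of optimal
selectors are almost-sure winning in the turn-based reduction. -/
theorem tbBase_mem_tbAlmostSure {D : Set S} (hD : D ⊆ F) {ξ : S → PMF M}
    (hopt : ∀ s ∈ D, ξ s ∈ G.OptSel Adm v s)
    (hcl : ∀ s ∈ D, ∀ b ∈ G.countOpt Adm v s (ξ s), ∀ a, ξ s a ≠ 0 → ∀ t,
      G.trans s a b t ≠ 0 → t ∈ D) {s : S} (hs : s ∈ D) :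
    G.tbBase Adm v s ∈ G.tbAlmostSure Adm v F := by
  have hch : ∀ x : G.TBState Adm v, ∃ y ∈ (G.tbGame Adm v).mov₁ x, ∀ s ∈ D,
      x = G.tbBase Adm v s → y.1 = .pair s (supp (ξ s)) (G.countOpt Adm v s (ξ s)) := by
    intro x
    by_cases h : ∃ s ∈ D, x = G.tbBase Adm v s
    · obtain ⟨s, hs, rfl⟩ := h
      obtain ⟨y, hy, hye⟩ := exists_mem_mov₁_pair (hopt s hs)
      refine ⟨y, hy, fun s' _ he => ?_⟩
      obtain rfl : s = s' := by simpa [tbBase] using congrArg (fun z => z.1) he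
      exact hye
    · obtain ⟨y, hy⟩ := (G.tbGame Adm v).mov₁_nonempty x
      exact ⟨y, hy, fun s hs he => absurd ⟨s, hs, he⟩ h⟩
  choose y hy hye using hch
  let σ : (G.tbGame Adm v).Selector₁ := ⟨fun x => PMF.pure (y x), fun x a ha =>
    PMF.pure_apply_ne_zero_iff.1 ha ▸ hy x⟩
  -- The closed set: `D` together with the intermediate states that arise when player 1 follows `ξ`
  -- on `D`.
  let P : TBName S M → Prop := fun
    | .base s => s ∈ D
    | .pair s A B => s ∈ D ∧ A = supp (ξ s) ∧ B = G.countOpt Adm v s (ξ s)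
    | .act s A b => s ∈ D ∧ A = supp (ξ s) ∧ b ∈ G.countOpt Adm v s (ξ s)
  refine mem_almostSure_of_selVal (ξ := σ) (selVal_eq_one_of_closed σ (Z := {x | P x.1}) ?_ ?_ hs)
  · rintro ⟨nm, h⟩ hx
    cases nm with
    | base s => exact hD hx
    | pair s A B => exact hD hx.1
    | act s A b => exact hD hx.1
  rintro ⟨nm, h⟩ hx b hb a ha t ht
  cases nm with
  | base s =>
    obtain rfl : t = a := PMF.pure_apply_ne_zero_iff.1 ht
    obtain rfl : t = y (G.tbBase Adm v s) := PMF.pure_apply_ne_zero_iff.1 ha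
    change P _
    rw [hye _ s hx rfl]
    exact ⟨hx, rfl, rfl⟩
  | pair s A B =>
    obtain rfl : t = b := PMF.pure_apply_ne_zero_iff.1 ht
    obtain ⟨hs, rfl, rfl⟩ := hx
    -- A counter-optimal move exists because a pure reply attains the infimum. So the state has a
    -- genuine edge, and the default self-loop of `tbSucc` does not intervene.
    obtain ⟨c, hc⟩ : (G.countOpt Adm v s (ξ s)).Nonempty := by
      classical
      obtain ⟨c, hc, hce⟩ := G.exists_le_preMix_pure v s (ξ s)
      exact ⟨c, by simp [countOpt, hc, hce, (hopt s hs).2]⟩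
    have h' : (supp (ξ s), G.countOpt Adm v s (ξ s)) ∈ G.OptSelCount Adm v s := h
    have e1 : TBEdge G (.pair s (supp (ξ s)) (G.countOpt Adm v s (ξ s)))
        (.act s (supp (ξ s)) c) := ⟨rfl, rfl, hc⟩
    have e2 := (mem_tbSucc (x := ⟨.pair s (supp (ξ s)) (G.countOpt Adm v s (ξ s)), h⟩)
      (y := ⟨.act s (supp (ξ s)) c, _, h', hc⟩) e1).1 hb
    obtain ⟨nt, hnt⟩ := t
    cases nt with
    | base => exact absurd e2 id
    | pair => exact absurd e2 id
    | act s' A' b' =>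
      obtain ⟨rfl, rfl, h3⟩ := e2
      exact ⟨hs, rfl, h3⟩
  | act s A b' =>
    obtain ⟨hs, rfl, hb'⟩ := hx
    obtain ⟨c, hc⟩ := (ξ s).support_nonempty
    obtain ⟨d, hd⟩ := (G.trans s c b').support_nonempty
    have e1 : TBEdge G (.act s (supp (ξ s)) b') (.base d) := ⟨c, mem_supp.2 hc, hd⟩
    have ht' : t ∈ G.tbSucc Adm v ⟨.act s (supp (ξ s)) b', h⟩ :=
      (tbGame_trans_ne_zero_iff (x := ⟨.act s (supp (ξ s)) b', h⟩) rfl a b).1 ht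
    have e2 := (mem_tbSucc (x := ⟨.act s (supp (ξ s)) b', h⟩) (y := G.tbBase Adm v d) e1).1 ht'
    obtain ⟨nt, hnt⟩ := t
    cases nt with
    | pair => exact absurd e2 id
    | act => exact absurd e2 id
    | base t =>
      obtain ⟨a', ha', h3⟩ := e2
      exact hcl s hs b' hb' a' (mem_supp.1 ha') t h3

theorem tbImprovable_subset : G.tbImprovable Adm F v ⊆ F := fun _ hs =>
  almostSure_subset (G := G.tbGame Adm v) hs.1

end Reduction

/-! ### Improvement steps, and optimality when none is possible. -/

section Improvement

variable {S M : Type*} [Fintype S] [Fintype M] {G : ConcurrentGame S M}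
  {Adm : S → Set (PMF M)} {F : Set S}

/-- If no improvement is possible, then `γ` is optimal among the memoryless strategies that use
selectors from `Adm`. -/
theorem selVal_le_of_noImprovement
    (habs : ∀ s ∈ G.almostSure F, G.Absorbing s) {γ : G.Selector₁}
    (hno : G.NoImprovement Adm F (selVal F γ)) {ξ : G.Selector₁} (hξ : ∀ s, ξ.1 s ∈ Adm s)
    (s₀ : S) : selVal F ξ s₀ ≤ selVal F γ s₀ := by
  classical
  by_contra! hlt
  have : Nonempty S := ⟨s₀⟩
  obtain ⟨sm, hm⟩ := Finite.exists_max fun s => selVal F ξ s - selVal F γ s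
  set m := selVal F ξ sm - selVal F γ sm with hmdef
  have hmpos : 0 < m := (sub_pos.2 hlt).trans_le (hm s₀)
  -- The states where `ξ` gains most over `γ`. They exclude unsafe states, where both valuations
  -- vanish, and states of value 1, which are absorbing, so that `γ` already has valuation 1 there.
  let D : Set S := {s | selVal F ξ s - selVal F γ s = m}
  have hDF : D ⊆ F := by
    intro s hs
    by_contra hsF
    have : selVal F ξ s - selVal F γ s = m := hs
    rw [selVal_of_notMem ξ hsF, selVal_of_notMem γ hsF] at this
    linarith
  have hDW : ∀ s ∈ D, s ∉ G.almostSure F := by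
    intro s hs hsW
    have h1 := selVal_eq_one_of_absorbing γ (hDF hs) (habs s hsW)
    have h2 : selVal F ξ s - selVal F γ s = m := hs
    have h3 := selVal_le_one (F := F) ξ s
    linarith
  have hsup : ∀ s ∈ D, G.preSup Adm (selVal F γ) s ≤ selVal F γ s := by
    intro s hs
    by_contra! h
    have : s ∈ G.improvable Adm F (selVal F γ) := ⟨hDF hs, hDW s hs, h⟩
    rw [hno.1] at this
    exact this
  -- Since `Val^ξ ≤ Val^γ + m` with equality at `s`, the fixed-point inequality for `ξ` shifts down
  -- by `m`. Together with `hsup` this makes `ξ` optimal for `Val^γ` on `D`.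
  have hmix : ∀ s ∈ D, ∀ b ∈ G.mov₂ s,
      selVal F γ s ≤ G.preMix (selVal F γ) s (ξ.1 s) (PMF.pure b) := by
    intro s hs b hb
    have h1 := selVal_le_preMix ξ (hDF hs) hb
    have h2 := G.preMix_mono (u := selVal F ξ) (v := fun t => selVal F γ t + m)
      (fun t => by linarith [hm t]) s (ξ.1 s) (PMF.pure b)
    rw [preMix_add, preMix_const] at h2
    have h3 : selVal F ξ s - selVal F γ s = m := hs
    linarith
  have hopt : ∀ s ∈ D, G.preSel (selVal F γ) s (ξ.1 s) = G.preSup Adm (selVal F γ) s :=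
    fun s hs => le_antisymm (G.preSel_le_preSup _ (hξ s))
      ((hsup s hs).trans (G.le_preSel_iff.2 (hmix s hs)))
  have key : G.tbBase Adm (selVal F γ) sm ∈ G.tbAlmostSure Adm (selVal F γ) F := by
    refine tbBase_mem_tbAlmostSure hDF (ξ := ξ.1) (fun s hs => ⟨hξ s, hopt s hs⟩) ?_
      (show sm ∈ D from rfl)
    intro s hs b hb a ha t ht
    simp only [countOpt, Finset.mem_filter] at hb
    -- Against a counter-optimal move the expectation of `Val^γ` is at most its value at `s`, while
    -- that of `Val^ξ` is at least its value at `s`. The expected difference is thus at least its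
    -- maximum `m`, which forces all successors into `D`.
    refine eq_of_preMix_pure_eq (v := fun t => selVal F ξ t - selVal F γ t) hm ?_ ha ht
    have h1 := selVal_le_preMix ξ (hDF hs) hb.1
    have h2 := G.preMix_add (fun t => selVal F ξ t - selVal F γ t) (selVal F γ) s (ξ.1 s)
      (PMF.pure b)
    simp only [sub_add_cancel] at h2
    have h3 : selVal F ξ s - selVal F γ s = m := hs
    have h4 := hsup s hs
    linarith [hb.2]
  have : sm ∈ G.tbImprovable Adm F (selVal F γ) := ⟨key, hDW sm rfl⟩
  rw [hno.2] at this
  exact this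

theorem ImproveByPre.selVal_le {γ γ' : G.Selector₁} (h : G.ImproveByPre Adm F γ γ') (s : S) :
    selVal F γ s ≤ selVal F γ' s := by
  obtain ⟨-, ξ, -, h2, h3, h4⟩ := h
  refine le_selVal γ' (fun s hs => selVal_of_notMem γ hs) (selVal_le_one γ) (fun s hs => ?_) s
  by_cases hI : s ∈ G.improvable Adm F (selVal F γ)
  · rw [h3 s hI, h2 s hI]
    exact hI.2.2.le
  · rw [h4 s hI, preSel_selVal γ hs]

/-- At an improvable state the new valuation is the one-step expectation of itself, hence at least
that of the old valuation, which already exceeds the old value. -/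
theorem ImproveByPre.exists_lt {γ γ' : G.Selector₁} (h : G.ImproveByPre Adm F γ γ') :
    ∃ s, selVal F γ s < selVal F γ' s := by
  have hle := h.selVal_le
  obtain ⟨⟨s, hs⟩, ξ, -, h2, h3, -⟩ := h
  refine ⟨s, ?_⟩
  calc _ < G.preSup Adm (selVal F γ) s := hs.2.2
    _ = G.preSel (selVal F γ) s (γ'.1 s) := by rw [h3 s hs, h2 s hs]
    _ ≤ G.preSel (selVal F γ') s (γ'.1 s) := G.preSel_mono hle s _
    _ = _ := preSel_selVal γ' hs.1

theorem preMix_pure_congr {u v : S → ℝ} {s : S} {x : PMF M} {b : M}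
    (h : ∀ a, x a ≠ 0 → ∀ t, G.trans s a b t ≠ 0 → u t = v t) :
    G.preMix u s x (PMF.pure b) = G.preMix v s x (PMF.pure b) := by
  rw [preMix_pure, preMix_pure]
  refine Finset.sum_congr rfl fun a _ => ?_
  by_cases ha : x a = 0
  · simp [ha]
  congr 1
  refine Finset.sum_congr rfl fun t _ => ?_
  by_cases ht : G.trans s a b t = 0
  · simp [ht]
  · rw [h a ha t ht]

open Classical in
-- The left side passes the submartingale test for `γ'`. On `U` it equals `(1 - ε) v + ε`, and this
-- formula also holds at states of value 1, where `v = 1`. Counter-optimal moves lead only to such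
-- states, so the test holds with equality for them; for other replies `ε` is taken below the gap.
theorem ImproveByTB.exists_add_le (habs : ∀ s ∈ G.almostSure F, G.Absorbing s)
    {γ γ' : G.Selector₁} (hγ : ∀ s, γ.1 s ∈ Adm s) (h : G.ImproveByTB Adm F γ γ') :
    ∃ ε > 0, ∀ s, selVal F γ s +
      (if s ∈ G.tbImprovable Adm F (selVal F γ) then ε * (1 - selVal F γ s) else 0) ≤
        selVal F γ' s := by
  obtain ⟨hI, -, σ, hσ, h1, h2⟩ := h
  set v := selVal F γ with hv
  set U := G.tbImprovable Adm F v with hU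
  have hUF : U ⊆ F := tbImprovable_subset
  have hsup : ∀ s ∈ U, G.preSup Adm v s = v s := by
    intro s hs
    refine le_antisymm ?_ ((preSel_selVal γ (hUF hs)).ge.trans (G.preSel_le_preSup v (hγ s)))
    by_contra! h
    have : s ∈ G.improvable Adm F v := ⟨hUF hs, hs.2, h⟩
    rw [hI] at this
    exact this
  have hge : ∀ s ∈ U, ∀ b ∈ G.mov₂ s, v s ≤ G.preMix v s (γ'.1 s) (PMF.pure b) := by
    intro s hs b hb
    rw [← hsup s hs, ← (h1 s hs).1.2]
    exact G.preSel_le_preMix _ _ hb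
  -- There are finitely many pairs `(s, b)`, so one `ε` lies below all the positive gaps.
  have hε : ∀ᶠ ε in 𝓝[>] (0 : ℝ), (0 < ε ∧ ε < 1) ∧ ∀ s b,
      v s < G.preMix v s (γ'.1 s) (PMF.pure b) →
        ε < G.preMix v s (γ'.1 s) (PMF.pure b) - v s := by
    refine Filter.Eventually.and (Ioo_mem_nhdsGT one_pos)
      (eventually_all.2 fun s => eventually_all.2 fun b => ?_)
    by_cases hlt : v s < G.preMix v s (γ'.1 s) (PMF.pure b)
    · filter_upwards [Ioo_mem_nhdsGT (sub_pos.2 hlt)] with ε hε _ using hε.2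
    · exact Eventually.of_forall fun _ h => absurd h hlt
  obtain ⟨ε, ⟨hε0, hε1⟩, hgap⟩ := hε.exists
  refine ⟨ε, hε0, ?_⟩
  have hv0 : ∀ s, 0 ≤ v s := selVal_nonneg γ
  have hv1 : ∀ s, v s ≤ 1 := selVal_le_one γ
  refine le_selVal γ' (fun s hs => ?_) (fun s => ?_) (fun s hs => ?_)
  · rw [if_neg fun h => hs (hUF h), hv, selVal_of_notMem γ hs, add_zero]
  · split_ifs
    · nlinarith [hv1 s]
    · linarith [hv1 s]
  have hmono : ∀ t, v t ≤ v t + (if t ∈ U then ε * (1 - v t) else 0) := by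
    intro t
    split_ifs
    · nlinarith [hv1 t]
    · linarith
  refine G.le_preSel_iff.2 fun b hb => ?_
  by_cases hsU : s ∈ U
  · rw [if_pos hsU]
    by_cases hb' : b ∈ G.countOpt Adm v s (γ'.1 s)
    · obtain ⟨-, y, hy, hσy⟩ := h1 s hsU
      have e : G.preMix (fun t => v t + if t ∈ U then ε * (1 - v t) else 0) s (γ'.1 s)
          (PMF.pure b) = G.preMix (fun t => (1 - ε) * v t + ε) s (γ'.1 s) (PMF.pure b) := by
        refine preMix_pure_congr fun a ha t ht => ?_
        have htb := hσ.succ_mem hsU.1 hy hσy (mem_supp.2 ha) hb' ht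
        by_cases htW : t ∈ G.almostSure F
        · have : v t = 1 := selVal_eq_one_of_absorbing γ (almostSure_subset htW) (habs t htW)
          rw [if_neg fun h => h.2 htW, this]
          ring
        · rw [if_pos ⟨htb, htW⟩]
          ring
      rw [e, preMix_add, preMix_const, preMix_const_mul]
      simp only [countOpt, Finset.mem_filter] at hb'
      rw [hb'.2, hsup s hsU]
      linarith
    · have hne : v s < G.preMix v s (γ'.1 s) (PMF.pure b) := by
        refine (hge s hsU b hb).lt_of_ne fun he => hb' ?_
        simp only [countOpt, Finset.mem_filter]
        exact ⟨hb, by rw [hsup s hsU, he]⟩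
      -- The gap exceeds `ε`, and the required gain `ε * (1 - v s)` is at most `ε`.
      have h3 := hgap s b hne
      have h4 := G.preMix_mono hmono s (γ'.1 s) (PMF.pure b)
      nlinarith [hv0 s]
  · rw [if_neg hsU, add_zero, h2 s hsU]
    exact (selVal_le_preMix γ hs hb).trans (G.preMix_mono hmono s _ _)

theorem ImproveByTB.selVal_le (habs : ∀ s ∈ G.almostSure F, G.Absorbing s)
    {γ γ' : G.Selector₁} (hγ : ∀ s, γ.1 s ∈ Adm s) (h : G.ImproveByTB Adm F γ γ') (s : S) :
    selVal F γ s ≤ selVal F γ' s := by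
  obtain ⟨ε, hε, hle⟩ := h.exists_add_le habs hγ
  refine le_trans ?_ (hle s)
  split_ifs
  · nlinarith [selVal_le_one (F := F) γ s]
  · linarith

theorem ImproveByTB.exists_lt (habs : ∀ s ∈ G.almostSure F, G.Absorbing s)
    {γ γ' : G.Selector₁} (hγ : ∀ s, γ.1 s ∈ Adm s) (h : G.ImproveByTB Adm F γ γ') :
    ∃ s, selVal F γ s < selVal F γ' s := by
  obtain ⟨ε, hε, hle⟩ := h.exists_add_le habs hγ
  obtain ⟨s, hs⟩ := h.2.1
  refine ⟨s, lt_of_lt_of_le ?_ (hle s)⟩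
  rw [if_pos hs]
  nlinarith [selVal_lt_one γ hs.2]

end Improvement

/-! ### Rational approximation of distributions. -/

section Rounding

variable {M : Type*} [Fintype M]

/-- Distributions are limits of rational ones with the same support. -/
theorem _root_.PMF.exists_rational_approx (x : PMF M) : ∃ z : ℕ → PMF M,
    (∀ n a, z n a ≠ 0 → x a ≠ 0) ∧
    (∀ n a, ∃ i : ℕ, i ≤ n + 1 ∧ (z n a).toReal = (i : ℝ) / ((n + 1 : ℕ) : ℝ)) ∧
    ∀ a, Tendsto (fun n => (z n a).toReal) atTop (𝓝 (x a).toReal) := by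
  classical
  obtain ⟨a₀, ha₀⟩ := x.support_nonempty
  let fl : ℕ → M → ℕ := fun n a => ⌊(x a).toReal * ((n + 1 : ℕ) : ℝ)⌋₊
  -- Round every numerator down and give the leftover mass to `a₀`. As `a₀` lies in the support of
  -- `x`, no new move enters the support.
  let r : ℕ → M → ℕ := fun n a =>
    if a = a₀ then n + 1 - ∑ c ∈ Finset.univ.erase a₀, fl n c else fl n a
  have hsum : ∀ n, ∑ c ∈ Finset.univ.erase a₀, fl n c ≤ n + 1 := by
    intro n
    have : ((∑ c ∈ Finset.univ.erase a₀, fl n c : ℕ) : ℝ) ≤ ((n + 1 : ℕ) : ℝ) := by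
      rw [Nat.cast_sum]
      calc _ ≤ ∑ c ∈ Finset.univ.erase a₀, (x c).toReal * ((n + 1 : ℕ) : ℝ) :=
            Finset.sum_le_sum fun c _ => Nat.floor_le (by positivity)
        _ ≤ ∑ c, (x c).toReal * ((n + 1 : ℕ) : ℝ) :=
            Finset.sum_le_sum_of_subset_of_nonneg (Finset.erase_subset _ _)
              fun c _ _ => by positivity
        _ = _ := by rw [← Finset.sum_mul, x.sum_toReal, one_mul]
    exact_mod_cast this
  have hr : ∀ n, ∑ a, r n a = n + 1 := by
    intro n
    rw [← Finset.add_sum_erase _ _ (Finset.mem_univ a₀)]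
    have : ∑ a ∈ Finset.univ.erase a₀, r n a = ∑ a ∈ Finset.univ.erase a₀, fl n a :=
      Finset.sum_congr rfl fun a ha => if_neg (Finset.ne_of_mem_erase ha)
    rw [this]
    simp only [r, if_true]
    exact Nat.sub_add_cancel (hsum n)
  have hpos : ∀ n : ℕ, (0 : ℝ) < ((n + 1 : ℕ) : ℝ) := fun n => by positivity
  let z : ℕ → PMF M := fun n => PMF.ofReal (fun a => (r n a : ℝ) / ((n + 1 : ℕ) : ℝ))
    (fun a => by positivity) (by
      rw [← Finset.sum_div, ← Nat.cast_sum, hr, div_self (hpos n).ne'])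
  have hz : ∀ n a, (z n a).toReal = (r n a : ℝ) / ((n + 1 : ℕ) : ℝ) := fun n a =>
    PMF.toReal_ofReal _ _ _ a
  have hfl : ∀ a, Tendsto (fun n => (fl n a : ℝ) / ((n + 1 : ℕ) : ℝ)) atTop
      (𝓝 (x a).toReal) := fun a =>
    (tendsto_nat_floor_mul_div_atTop (R := ℝ) (a := (x a).toReal) ENNReal.toReal_nonneg).comp
      (tendsto_natCast_atTop_atTop.comp (tendsto_add_atTop_nat 1))
  refine ⟨z, fun n a h => ?_, fun n a => ⟨r n a, ?_, hz n a⟩, fun a => ?_⟩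
  · by_cases ha : a = a₀
    · exact ha ▸ ha₀
    · intro hx
      rw [← PMF.toReal_ne_zero_iff, hz] at h
      simp [r, ha, fl, hx] at h
  · rw [← hr n]
    exact Finset.single_le_sum (fun _ _ => Nat.zero_le _) (Finset.mem_univ a)
  · simp only [hz]
    by_cases ha : a = a₀
    · subst ha
      have h1 : Tendsto (fun n : ℕ => 1 - ∑ c ∈ Finset.univ.erase a,
          (fl n c : ℝ) / ((n + 1 : ℕ) : ℝ)) atTop
          (𝓝 (1 - ∑ c ∈ Finset.univ.erase a, (x c).toReal)) :=
        tendsto_const_nhds.sub (tendsto_finsetSum _ fun c _ => hfl c)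
      have h2 : 1 - ∑ c ∈ Finset.univ.erase a, (x c).toReal = (x a).toReal := by
        rw [← x.sum_toReal, ← Finset.add_sum_erase _ _ (Finset.mem_univ a)]
        ring
      rw [h2] at h1
      refine h1.congr fun n => ?_
      simp only [r, if_true]
      rw [Nat.cast_sub (hsum n), Nat.cast_sum, sub_div, div_self (hpos n).ne', Finset.sum_div]
    · simpa only [r, if_neg ha] using hfl a

end Rounding

/-! ### Near-optimality of `k`-uniform selectors. -/

section UniformSelectors

variable {S M : Type*} [Fintype S] [Fintype M] {G : ConcurrentGame S M} {F : Set S}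

theorem SelK_mono {k l : ℕ} (h : k ≤ l) (s : S) : G.SelK F k s ⊆ G.SelK F l s := by
  refine fun x hx => ⟨hx.1, fun h1 h2 a ha => ?_⟩
  obtain ⟨i, j, h3, h4, h5, h6⟩ := hx.2 h1 h2 a ha
  exact ⟨i, j, h3, h4, h5.trans h, h6⟩

theorem uniformSelector_mem_SelK {k : ℕ} (hk : Fintype.card M ≤ k) (s : S) :
    G.uniformSelector.1 s ∈ G.SelK F k s := by
  refine ⟨G.uniformSelector.2 s, fun _ _ a ha => ⟨1, (G.mov₁ s).card, ?_, ?_, ?_, ?_⟩⟩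
  · exact (G.mov₁_nonempty s).card_pos
  · exact (G.mov₁_nonempty s).card_pos
  · exact (Finset.card_le_univ _).trans hk
  · have h := PMF.uniformOfFinset_apply_of_mem (G.mov₁_nonempty s) (G.uniformSelector.2 s a ha)
    refine (congrArg ENNReal.toReal h).trans ?_
    simp

/-- Near-optimal memoryless strategies with rational probabilities. -/
theorem exists_rational_near_optimal (G : ConcurrentGame S M) (F : Set S) {ε : ℝ} (hε : 0 < ε) :
    ∃ k, ∃ ζ : G.Selector₁, (∀ s, ζ.1 s ∈ G.SelK F k s) ∧
      ∀ s, G.val (SafePlays F) s - ε ≤ selVal F ζ s := by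
  obtain ⟨ξ, hξ⟩ := exists_selVal_eq_val G F
  rw [← hξ]
  set w := selVal F ξ with hw
  have hw0 : ∀ s, 0 ≤ w s := selVal_nonneg ξ
  have hw1 : ∀ s, w s ≤ 1 := selVal_le_one ξ
  obtain ⟨δ, hδ0, hδ1, hδε⟩ : ∃ δ : ℝ, 0 < δ ∧ δ ≤ 1 ∧ δ ≤ ε :=
    ⟨min 1 ε, lt_min one_pos hε, min_le_left _ _, min_le_right _ _⟩
  -- Here `u = w - δ w (1 - w)`, which lies between `w - ε` and `w`, and is an increasing, strictly
  -- convex function of `w` on `[0, 1]`.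
  let u : S → ℝ := fun s => (1 - δ) * w s + δ * (w s * w s)
  have hu : ∀ (s : S) (x y : PMF M), G.preMix u s x y =
      (1 - δ) * G.preMix w s x y + δ * G.preMix (fun t => w t * w t) s x y := fun s x y => by
    rw [preMix_add, preMix_const_mul, preMix_const_mul]
  choose z hzs hzq hzl using fun s => PMF.exists_rational_approx (ξ.1 s)
  have hev : ∀ s, ∀ b, ∀ᶠ n in atTop, s ∈ F → b ∈ G.mov₂ s →
      u s ≤ G.preMix u s (z s n) (PMF.pure b) := by
    intro s b
    by_cases hs : s ∈ F
    swap
    · exact Eventually.of_forall fun _ h => absurd h hs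
    by_cases hb : b ∈ G.mov₂ s
    swap
    · exact Eventually.of_forall fun _ _ h => absurd h hb
    set m := G.preMix w s (ξ.1 s) (PMF.pure b) with hm
    have hwm : w s ≤ m := selVal_le_preMix ξ hs hb
    have hum : u s ≤ (1 - δ) * m + δ * (m * m) := by
      have h1 : w s * w s ≤ m * m := mul_self_le_mul_self (hw0 s) hwm
      have h2 := mul_le_mul_of_nonneg_left hwm (sub_nonneg.2 hδ1)
      have h3 := mul_le_mul_of_nonneg_left h1 hδ0.le
      linarith
    -- The variance identity. The variance appears with a minus sign so that its vanishing is an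
    -- instance of a maximum attained in expectation.
    have hvar : G.preMix (fun t => w t * w t) s (ξ.1 s) (PMF.pure b) =
        m * m - G.preMix (fun t => -((w t - m) * (w t - m))) s (ξ.1 s) (PMF.pure b) := by
      have e : (fun t => -((w t - m) * (w t - m))) =
          fun t => ((-1) * (w t * w t) + (2 * m) * w t) + (-(m * m)) := by
        funext t; ring
      rw [e, preMix_add, preMix_add, preMix_const_mul, preMix_const_mul, preMix_const, ← hm]
      ring
    have hneg : ∀ t, -((w t - m) * (w t - m)) ≤ 0 := fun t =>
      neg_nonpos.2 (mul_self_nonneg _)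
    rcases le_or_gt 0 (G.preMix (fun t => -((w t - m) * (w t - m))) s (ξ.1 s) (PMF.pure b))
      with h0 | h0
    -- Zero variance: `w` equals `m` at all successors under the support of `ξ`. Rounding stays
    -- within that support, so it leaves the expectation of `u` unchanged.
    · refine Eventually.of_forall fun n _ _ => ?_
      rw [preMix_pure_congr (v := fun _ => (1 - δ) * m + δ * (m * m)) fun a ha t ht => ?_]
      · rwa [preMix_const]
      · have h4 := eq_of_preMix_pure_eq hneg h0 (hzs s n a ha) ht
        have h5 : w t = m := by
          rw [neg_eq_zero, mul_self_eq_zero] at h4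
          linarith
        simp only [u, h5]
    -- Positive variance: Jensen's inequality is strict, and a strict inequality survives rounding
    -- for large `n`.
    · have hlt : u s < G.preMix u s (ξ.1 s) (PMF.pure b) := by
        rw [hu, hvar, ← hm]
        nlinarith
      have hl := G.tendsto_preMix_pure (v := fun _ => u) (fun t => tendsto_const_nhds) (hzl s) s b
      filter_upwards [hl.eventually_const_lt hlt] with n hn _ _ using hn.le
  obtain ⟨n, hn⟩ := (eventually_all.2 fun s => eventually_all.2 fun b => hev s b).exists
  let ζ : G.Selector₁ := ⟨fun s => z s n, fun s a ha => ξ.2 s a (hzs s n a ha)⟩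
  refine ⟨n + 1, ζ, fun s => ⟨ζ.2 s, fun _ _ a _ => ?_⟩, fun s => ?_⟩
  · obtain ⟨i, hi, he⟩ := hzq s n a
    exact ⟨i, n + 1, n.succ_pos, hi, le_rfl, he⟩
  · refine le_trans ?_ (le_selVal ζ (u := u) (fun s hs => ?_) (fun s => ?_)
      (fun s hs => G.le_preSel_iff.2 fun b hb => hn s b hs hb) s)
    · simp only [u]
      nlinarith [hw0 s, hw1 s, mul_nonneg (hw0 s) (hw0 s)]
    · simp only [u, hw, selVal_of_notMem ξ hs]
      ring
    · simp only [u]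
      nlinarith [hw0 s, hw1 s, mul_nonneg (hw0 s) (sub_nonneg.2 (hw1 s))]

end UniformSelectors

/-! ### Termination of the restricted algorithm and existence of runs. -/

section Termination

variable {S M : Type*} [Fintype S] [Fintype M] {G : ConcurrentGame S M} {F : Set S}

theorem _root_.PMF.toReal_injective {α : Type*} :
    Function.Injective fun (p : PMF α) a => (p a).toReal := fun p q h =>
  PMF.ext fun a => (ENNReal.toReal_eq_toReal_iff' (p.apply_ne_top a) (q.apply_ne_top a)).1
    (congrFun h a)

/-- Zero and the fractions with denominator at most `k`. -/
def fractions (k : ℕ) : Set ℝ :=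
  (fun p : ℕ × ℕ => (p.1 : ℝ) / p.2) '' (Set.Iic k ×ˢ Set.Iic k)

theorem finite_fractions (k : ℕ) : (fractions k).Finite :=
  ((Set.finite_Iic k).prod (Set.finite_Iic k)).image _

theorem toReal_mem_fractions {k : ℕ} {s : S} (hs : s ∈ F) (hW : s ∉ G.almostSure F) {x : PMF M}
    (hx : x ∈ G.SelK F k s) (a : M) : (x a).toReal ∈ fractions k := by
  by_cases ha : x a = 0
  · exact ⟨(0, 0), ⟨Nat.zero_le k, Nat.zero_le k⟩, by simp [ha]⟩
  · obtain ⟨i, j, -, h1, h2, h3⟩ := hx.2 hs hW a ha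
    exact ⟨(i, j), ⟨h1.trans h2, h2⟩, h3.symm⟩

theorem finite_SelK (k : ℕ) {s : S} (hs : s ∈ F) (hW : s ∉ G.almostSure F) :
    (G.SelK F k s).Finite :=
  Set.Finite.of_finite_image
    ((Set.Finite.pi' fun _ : M => finite_fractions k).subset (by
      rintro _ ⟨x, hx, rfl⟩ a
      exact toReal_mem_fractions hs hW hx a))
    (PMF.toReal_injective.injOn)

theorem optSel_SelK_nonempty {k : ℕ} (hk : Fintype.card M ≤ k) (v : S → ℝ) {s : S} (hs : s ∈ F)
    (hW : s ∉ G.almostSure F) : (G.OptSel (G.SelK F k) v s).Nonempty := by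
  have hne : (G.SelK F k s).Nonempty := ⟨_, uniformSelector_mem_SelK hk s⟩
  obtain ⟨x, hx, hmax⟩ := Set.exists_max_image _ (G.preSel v s) (finite_SelK k hs hW) hne
  exact ⟨x, hx, le_antisymm (G.preSel_le_preSup v hx) (G.preSup_le hne hmax)⟩

/-- The selectors that the `k`-uniform algorithm can meet: `k`-uniform, and unchanged at the unsafe
states and the states of value 1. -/
def KInvariant (G : ConcurrentGame S M) (F : Set S) (k : ℕ) : Set G.Selector₁ :=
  {γ | (∀ s, γ.1 s ∈ G.SelK F k s) ∧
    ∀ s, s ∉ F ∨ s ∈ G.almostSure F → γ.1 s = G.uniformSelector.1 s}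

/-- At unsafe states and states of value 1, `SelK` imposes no denominator bound; finiteness there
comes from the selector never being changed. -/
theorem finite_KInvariant (k : ℕ) : (KInvariant G F k).Finite := by
  refine Set.Finite.of_finite_image (f := fun γ s a => (γ.1 s a).toReal)
    ((Set.Finite.pi' fun s : S => Set.Finite.pi' fun a : M =>
      (finite_fractions k).insert (G.uniformSelector.1 s a).toReal).subset ?_) ?_
  · rintro _ ⟨γ, hγ, rfl⟩ s a
    by_cases h : s ∉ F ∨ s ∈ G.almostSure F
    · exact Set.mem_insert_iff.2 (Or.inl
        (congrArg (fun x : PMF M => (x a).toReal) (hγ.2 s h)))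
    · rw [not_or, not_not] at h
      exact Set.mem_insert_of_mem _ (toReal_mem_fractions h.1 h.2 (hγ.1 s) a)
  · intro γ _ γ' _ h
    exact Subtype.ext (funext fun s => PMF.toReal_injective (congrFun h s))

theorem KStep.mem_KInvariant {k : ℕ} {γ γ' : G.Selector₁} (h : G.KStep F k γ γ')
    (hγ : γ ∈ KInvariant G F (max k (Fintype.card M))) :
    γ' ∈ KInvariant G F (max k (Fintype.card M)) := by
  rcases h with ⟨-, ξ, h1, -, h2, h3⟩ | ⟨-, -, σ, -, h2, h3⟩
  · refine ⟨fun s => ?_, fun s hs => ?_⟩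
    · by_cases hI : s ∈ G.improvable (G.SelK F (max k (Fintype.card M))) F (selVal F γ)
      · exact h2 s hI ▸ h1 s
      · exact h3 s hI ▸ hγ.1 s
    · rw [h3 s fun h => hs.elim (fun h' => h' h.1) h.2.1]
      exact hγ.2 s hs
  · refine ⟨fun s => ?_, fun s hs => ?_⟩
    · by_cases hI : s ∈ G.tbImprovable (G.SelK F (max k (Fintype.card M))) F (selVal F γ)
      · exact (h2 s hI).1.1
      · exact h3 s hI ▸ hγ.1 s
    · rw [h3 s fun h => hs.elim (fun h' => h' (tbImprovable_subset h)) h.2]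
      exact hγ.2 s hs

theorem uniformSelector_mem_KInvariant (k : ℕ) :
    G.uniformSelector ∈ KInvariant G F (max k (Fintype.card M)) :=
  ⟨uniformSelector_mem_SelK (le_max_right _ _), fun _ _ => rfl⟩

theorem KReachable.mem_KInvariant {k : ℕ} {γ : G.Selector₁} (h : G.KReachable F k γ) :
    γ ∈ KInvariant G F (max k (Fintype.card M)) := by
  induction h with
  | refl => exact uniformSelector_mem_KInvariant k
  | tail _ h ih => exact h.mem_KInvariant ih

theorem KStep.selVal_lt (habs : ∀ s ∈ G.almostSure F, G.Absorbing s) {k : ℕ}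
    {γ γ' : G.Selector₁} (h : G.KStep F k γ γ')
    (hγ : γ ∈ KInvariant G F (max k (Fintype.card M))) : selVal F γ < selVal F γ' := by
  rw [Pi.lt_def]
  rcases h with h | h
  · exact ⟨h.selVal_le, h.exists_lt⟩
  · exact ⟨h.selVal_le habs hγ.1, h.exists_lt habs hγ.1⟩

theorem KReachable.selVal_uniformSelector_le (habs : ∀ s ∈ G.almostSure F, G.Absorbing s) {k : ℕ}
    {γ : G.Selector₁} (h : G.KReachable F k γ) : selVal F G.uniformSelector ≤ selVal F γ := by
  induction h with
  | refl => exact le_rfl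
  | tail h₀ h ih => exact ih.trans (h.selVal_lt habs (KReachable.mem_KInvariant h₀)).le

/-- Valuations strictly increase, so selectors never repeat, but only finitely many satisfy the
invariant. -/
theorem not_exists_infinite_execution (habs : ∀ s ∈ G.almostSure F, G.Absorbing s) (k : ℕ) :
    ¬ ∃ g : ℕ → G.Selector₁, g 0 = G.uniformSelector ∧ ∀ n, G.KStep F k (g n) (g (n + 1)) := by
  rintro ⟨g, h0, hg⟩
  have hinv : ∀ n, g n ∈ KInvariant G F (max k (Fintype.card M)) := by
    intro n
    induction n with
    | zero => exact h0 ▸ uniformSelector_mem_KInvariant k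
    | succ n ih => exact (hg n).mem_KInvariant ih
  have hmono : StrictMono fun n => selVal F (g n) :=
    strictMono_nat_of_lt_succ fun n => (hg n).selVal_lt habs (hinv n)
  exact Set.infinite_of_injective_forall_mem (f := g)
    (fun m n h => hmono.injective (congrArg (selVal F) h)) hinv (finite_KInvariant _)

/-- The algorithm never gets stuck: finiteness of the `k`-uniform selectors provides optimal ones,
the reduction has a pure winning strategy, and each pair it chooses is realized by an optimal
selector. -/
theorem KFinal_or_exists_KStep (k : ℕ) (γ : G.Selector₁) :
    G.KFinal F k γ ∨ ∃ γ', G.KStep F k γ γ' := by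
  classical
  set K := max k (Fintype.card M)
  have hopt : ∀ s, s ∈ F → s ∉ G.almostSure F →
      (G.OptSel (G.SelK F K) (selVal F γ) s).Nonempty :=
    fun s => optSel_SelK_nonempty (le_max_right _ _) _
  rcases Set.eq_empty_or_nonempty (G.improvable (G.SelK F K) F (selVal F γ)) with hI | hI
  · rcases Set.eq_empty_or_nonempty (G.tbImprovable (G.SelK F K) F (selVal F γ)) with hU | hU
    · exact Or.inl ⟨hI, hU⟩
    right
    obtain ⟨σ, hp, hσ⟩ := exists_pure_winning (G.tbGame (G.SelK F K) (selVal F γ))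
      (G.tbSafe (G.SelK F K) (selVal F γ) F)
    have hx : ∀ s, ∃ x ∈ G.Sel₁ s,
        (s ∈ G.tbImprovable (G.SelK F K) F (selVal F γ) →
          x ∈ G.OptSel (G.SelK F K) (selVal F γ) s ∧
          ∃ y : G.TBState (G.SelK F K) (selVal F γ),
            y.1 = .pair s (supp x) (G.countOpt (G.SelK F K) (selVal F γ) s x) ∧
            σ.1 (G.tbBase (G.SelK F K) (selVal F γ) s) = PMF.pure y) ∧
        (s ∉ G.tbImprovable (G.SelK F K) F (selVal F γ) → x = γ.1 s) := by
      intro s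
      by_cases hs : s ∈ G.tbImprovable (G.SelK F K) F (selVal F γ)
      · obtain ⟨y, hy⟩ := hp (G.tbBase (G.SelK F K) (selVal F γ) s)
        have hy' := σ.2 (G.tbBase (G.SelK F K) (selVal F γ) s) y
          (by rw [hy]; exact PMF.pure_apply_ne_zero_iff.2 rfl)
        obtain ⟨x, hx, hxy⟩ :=
          exists_optSel_of_mem_mov₁ (hopt s (tbImprovable_subset hs) hs.2) hy'
        exact ⟨x, hx.1.1, fun _ => ⟨hx, y, hxy, hy⟩, fun h => absurd hs h⟩
      · exact ⟨γ.1 s, γ.2 s, fun h => absurd h hs, fun _ => rfl⟩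
    choose x hx1 hx2 hx3 using hx
    exact ⟨⟨x, hx1⟩, Or.inr ⟨hI, hU, σ, ⟨hp, hσ⟩, hx2, hx3⟩⟩
  · right
    have hx : ∀ s, ∃ x ∈ G.SelK F K s,
        (s ∈ G.improvable (G.SelK F K) F (selVal F γ) →
          G.preSel (selVal F γ) s x = G.preSup (G.SelK F K) (selVal F γ) s) := by
      intro s
      by_cases hs : s ∈ G.improvable (G.SelK F K) F (selVal F γ)
      · obtain ⟨x, hx⟩ := hopt s hs.1 hs.2.1
        exact ⟨x, hx.1, fun _ => hx.2⟩
      · exact ⟨_, uniformSelector_mem_SelK (le_max_right _ _) s, fun h => absurd h hs⟩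
    choose x hx1 hx2 using hx
    let ξ : G.Selector₁ := ⟨x, fun s => (hx1 s).1⟩
    let γ' : G.Selector₁ := ⟨fun s => if s ∈ G.improvable (G.SelK F K) F (selVal F γ) then x s
      else γ.1 s, fun s => by
        beta_reduce
        split_ifs
        · exact (hx1 s).1
        · exact γ.2 s⟩
    exact ⟨γ', Or.inl ⟨hI, ξ, hx1, hx2, fun s hs => if_pos hs, fun s hs => if_neg hs⟩⟩

theorem kTerminates (habs : ∀ s ∈ G.almostSure F, G.Absorbing s) (k : ℕ) : G.KTerminates F k :=
  ⟨not_exists_infinite_execution habs k, fun γ _ => KFinal_or_exists_KStep k γ⟩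

theorem exists_KOutput (habs : ∀ s ∈ G.almostSure F, G.Absorbing s) (k : ℕ) :
    ∃ γ, G.KOutput F k γ := by
  by_contra! h
  have hstep : ∀ γ : {γ // G.KReachable F k γ}, ∃ γ' : {γ // G.KReachable F k γ},
      G.KStep F k γ.1 γ'.1 := by
    rintro ⟨γ, hγ⟩
    obtain ⟨γ', hγ'⟩ := (KFinal_or_exists_KStep k γ).resolve_left fun hf => h γ ⟨hγ, hf⟩
    exact ⟨⟨γ', hγ.tail hγ'⟩, hγ'⟩
  choose next hnext using hstep
  have h0 : G.KReachable F k G.uniformSelector := Relation.ReflTransGen.refl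
  let g : ℕ → {γ // G.KReachable F k γ} := fun n => n.rec ⟨G.uniformSelector, h0⟩ fun _ => next
  exact not_exists_infinite_execution habs k ⟨fun n => (g n).1, rfl, fun n => hnext (g n)⟩

theorem exists_isRun (habs : ∀ s ∈ G.almostSure F, G.Absorbing s) :
    ∃ γ : ℕ → G.Selector₁, G.IsRun F γ := by
  classical
  choose out hout using exists_KOutput habs
  -- The run that ignores the stopping condition. If it first fulfils that condition at index `N`,
  -- then iteration `N` still computes the term `N + 1`, so the sequence is frozen from `N + 1` on.
  let η : ℕ → G.Selector₁ := fun i =>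
    i.casesOn G.uniformSelector fun i => out (Fintype.card M + i)
  by_cases hst : ∃ j, G.Stops F (η j)
  · let N := Nat.find hst
    have hN : G.Stops F (η N) := Nat.find_spec hst
    have hlt : ∀ j < N, ¬ G.Stops F (η j) := fun j hj => Nat.find_min hst hj
    obtain ⟨γ, hle, hge⟩ : ∃ γ : ℕ → G.Selector₁,
        (∀ i ≤ N + 1, γ i = η i) ∧ ∀ i ≥ N + 1, γ i = η (N + 1) :=
      ⟨fun i => η (min i (N + 1)), fun i hi => congrArg η (min_eq_left hi),
        fun i hi => congrArg η (min_eq_right hi)⟩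
    refine ⟨γ, hle 0 (Nat.zero_le _), fun i => ⟨fun h => ?_, ?_⟩⟩
    · have hi : i ≤ N := by
        by_contra! hi
        exact h N hi (hle N (Nat.le_succ N) ▸ hN)
      rw [hle (i + 1) (Nat.succ_le_succ hi)]
      exact hout _
    · rintro ⟨j, hj, hs⟩
      have hi : N + 1 ≤ i := by
        by_contra! hi
        have hjN : j < N := hj.trans_le (Nat.le_of_lt_succ hi)
        exact hlt j hjN (hle j (hjN.le.trans (Nat.le_succ N)) ▸ hs)
      rw [hge i hi, hge (i + 1) (hi.trans (Nat.le_succ i))]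
  · push Not at hst
    exact ⟨η, rfl, fun i => ⟨fun _ => hout _, fun ⟨j, _, hj⟩ => absurd hj (hst j)⟩⟩

end Termination

/-! ### Monotonicity, optimality and convergence of runs. -/

section Runs

variable {S M : Type*} [Fintype S] [Fintype M] {G : ConcurrentGame S M} {F : Set S}

theorem KOutput.selVal_le (habs : ∀ s ∈ G.almostSure F, G.Absorbing s) {k l : ℕ}
    (hlk : l ≤ max k (Fintype.card M)) {γ : G.Selector₁} (hγ : G.KOutput F k γ)
    {ξ : G.Selector₁} (hξ : ∀ s, ξ.1 s ∈ G.SelK F l s) (s : S) : selVal F ξ s ≤ selVal F γ s :=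
  selVal_le_of_noImprovement habs hγ.2 (fun s => SelK_mono hlk s (hξ s)) s

/-- The previous output is admissible for the larger `k` of the next iteration, whose output beats
all admissible selectors. The first iteration starts from the uniform selector itself and only
improves it. -/
theorem IsRun.selVal_le_succ (habs : ∀ s ∈ G.almostSure F, G.Absorbing s)
    {γ : ℕ → G.Selector₁} (h : G.IsRun F γ) (i : ℕ) (s : S) :
    selVal F (γ i) s ≤ selVal F (γ (i + 1)) s := by
  by_cases hst : ∃ j < i, G.Stops F (γ j)
  · rw [(h.2 i).2 hst]
  push Not at hst
  have hout := (h.2 i).1 hst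
  cases i with
  | zero => exact h.1 ▸ hout.1.selVal_uniformSelector_le habs s
  | succ i =>
    have hprev := (h.2 i).1 fun j hj => hst j (by lia)
    exact hout.selVal_le habs (by lia) hprev.1.mem_KInvariant.1 s

theorem Stops.selVal_eq (habs : ∀ s ∈ G.almostSure F, G.Absorbing s) {γ : G.Selector₁}
    (h : G.Stops F γ) : selVal F γ = G.val (SafePlays F) := by
  obtain ⟨ξ, hξ⟩ := exists_selVal_eq_val G F
  refine funext fun s => le_antisymm (selVal_le_val γ s) ?_
  rw [← hξ]
  exact selVal_le_of_noImprovement habs h ξ.2 s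

/-- If the run never stops, its denominator bound eventually reaches that of a rational `ε`-optimal
selector, and the output of that iteration is at least as good. -/
theorem IsRun.exists_val_sub_le (habs : ∀ s ∈ G.almostSure F, G.Absorbing s)
    {γ : ℕ → G.Selector₁} (h : G.IsRun F γ) {ε : ℝ} (hε : 0 < ε) :
    ∃ i, ∀ s, G.val (SafePlays F) s - ε ≤ selVal F (γ i) s := by
  by_cases hst : ∃ j, G.Stops F (γ j)
  · obtain ⟨j, hj⟩ := hst
    refine ⟨j, fun s => ?_⟩
    rw [hj.selVal_eq habs]
    linarith
  push Not at hst
  obtain ⟨k, ζ, hζ, hle⟩ := exists_rational_near_optimal G F hε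
  have hout := (h.2 k).1 fun j _ => hst j
  exact ⟨k + 1, fun s => (hle s).trans (hout.selVal_le habs (by lia) hζ s)⟩

end Runs

end ConcurrentGame

end

/-! ### The main theorem. -/

theorem theorem8 {S M : Type*} [Fintype S] [Fintype M] (G : ConcurrentGame S M) (F : Set S)
    (habs : ∀ s, s ∉ F ∨ s ∈ G.almostSure F → G.Absorbing s) :
    (∀ k : ℕ, G.KTerminates F k) ∧
    (∃ γ : ℕ → G.Selector₁, G.IsRun F γ) ∧
    ∀ γ : ℕ → G.Selector₁, G.IsRun F γ →
      (∀ i s, ConcurrentGame.selVal F (γ i) s ≤ ConcurrentGame.selVal F (γ (i + 1)) s) ∧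
      (∀ i, G.Stops F (γ i) →
        ConcurrentGame.selVal F (γ i) = G.val (SafePlays F) ∧
        ConcurrentGame.selVal F (γ (i + 1)) = G.val (SafePlays F)) ∧
      (∀ ε : ℝ, 0 < ε → ∃ i, ∀ s,
        G.val (SafePlays F) s - ε ≤ ConcurrentGame.selVal F (γ i) s) ∧
      (∀ i s, ConcurrentGame.selVal F (γ i) s ≤ G.val (SafePlays F) s) ∧
      Filter.Tendsto (fun i => ConcurrentGame.selVal F (γ i)) Filter.atTop
        (nhds (G.val (SafePlays F))) := by
  have habs' : ∀ s ∈ G.almostSure F, G.Absorbing s := fun s hs => habs s (Or.inr hs)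
  refine ⟨ConcurrentGame.kTerminates habs', ConcurrentGame.exists_isRun habs', fun γ hγ => ?_⟩
  have hmono := hγ.selVal_le_succ habs'
  refine ⟨hmono, fun i hi => ?_, fun ε hε => hγ.exists_val_sub_le habs' hε,
    fun i => ConcurrentGame.selVal_le_val (γ i), ?_⟩
  · have h1 := ConcurrentGame.Stops.selVal_eq habs' hi
    refine ⟨h1, funext fun s => le_antisymm (ConcurrentGame.selVal_le_val _ s) ?_⟩
    rw [← h1]
    exact hmono i s
  · refine tendsto_pi_nhds.2 fun s => Metric.tendsto_atTop.2 fun ε hε => ?_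
    obtain ⟨N, hN⟩ := hγ.exists_val_sub_le habs' (half_pos hε)
    refine ⟨N, fun n hn => ?_⟩
    have h1 : ConcurrentGame.selVal F (γ N) s ≤ ConcurrentGame.selVal F (γ n) s :=
      monotone_nat_of_le_succ (f := fun i => ConcurrentGame.selVal F (γ i) s)
        (fun i => hmono i s) hn
    have h2 := ConcurrentGame.selVal_le_val (F := F) (γ n) s
    have h3 := hN s
    rw [Real.dist_eq, abs_lt]
    constructor <;> linarith
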